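/- **Setting.** Let $0=a_0<\dots<a_N=1$ and let $T:[0,1]\to[0,1]$ be such that each $T|_{[a_{k-1},a_k)}$ is continuous, strictly increasing and non-singular for Lebesgue measure; $T$ is left-continuous at $1$. Let $\psi_k:[0,1]\to[a_{k-1},a_k]$ be the inverse of the $k$-th branch, extended by the constants $a_{k-1}$ below and $a_k$ above the range of the branch. Suppose that $T$ is *$a$-convex*: $T'(0)>1$, the right derivative of $T$ at each $a_{k-1}$ ($1\le k\le N$) exists and is positive, and for each $1\le k\le N$ the function $\sum_{i\le k}\psi_i$ is differentiable off a countable set with non-increasing derivative. At all points let $\psi_i'$ denote the left derivative of $\psi_i$ (the right derivative at $0$); this makes the sums $\sum_{i\le k}\psi_i'$ upper semicontinuous. Let $\beta=\sup\bigcup_{i\ge0}T^i[0,a_1]$, and suppose that $\beta=a_{k}$ for some $k$ (which can be arranged by splitting a branch). Let $V$ consist of $0$, $1$ and the points of $(0,1)$ at which some $\sum_{i\le k}\psi_i'$ has different one-sided limits, and let $W=\bigcup_{i\ge0}T^{-i}\bigl(\bigcup_{j\ge0}T^jV\bigr)\setminus\{0,1\}$. Let $\overline{[0,1]}$ be obtained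 from $[0,1]$ by replacing each $x\in W$ by two points $x^-<x^+$, with the induced linear order and the order topology; $T$, $\psi_k$ and $\psi_k'$ extend to $\overline{[0,1]}$ by one-sided limits. For $s>0$ put $F_sf=\sum_{k=1}^N(\psi_k')^s\,f\circ\psi_k$. A *conformal measure* is a Borel probability measure $m_s$ on $\overline{[0,1]}$ with $\gamma:=\int F_s\mathbf 1\,dm_s>0$ and $\int F_sf\,dm_s=\gamma\int f\,dm_s$ for all $f\in C(\overline{[0,1]})$. Let $\mathcal J$ be the cone of non-negative non-increasing real functions on $[0,1]$. Consider the conditions (B) there are $M_r>0$ with $M_r\to0$ such that $\inf_n\gamma^{-n}\|F_s^n\chi_I\|_\infty\le M_r$ for every cylinder $I=\bigcap_{i<r}T^{-i}[a_{d_i-1}^+,a_{d_i}^-]\subseteq\overline{[0,1]}$ of length $r$ that contains neither $\beta^-$ nor $\beta^+$ (that does not contain $\beta$, if $\beta\notin W$); (C) $\sum_{i\le k}(\psi_i')^s\in\mathcal J$ for every $1\le k\le N$. **Theorem.** Let $T$ be $a$-convex, $s>0$, and let $m_s$ be a conformal measure such that (B) and (C) hold. Then there is a $T$-invariant Borel probability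 measure $\mu_s$ on $\overline{[0,1]}$ which is absolutely continuous with respect to $m_s$ and has a non-negative, non-increasing real-valued density $g=d\mu_s/dm_s$. If moreover $m_s$ gives measure zero to the set $\{x^\pm:x\in W\}$ of duplicated points, so that $m_s$ is a measure on $[0,1]$, then there is a Borel probability measure $\mu_s$ on $[0,1]$, invariant under $T:[0,1]\to[0,1]$ and absolutely continuous with respect to $m_s$, with a density $g=d\mu_s/dm_s\in\mathcal J$. -/

import Mathlib

open Set Filter Topology MeasureTheory

noncomputable section

/-- A non-singular, piecewise monotone, orientation-preserving map of `[0,1]` with branches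
`[a k, a (k+1))`, `k < N`. Only the values of `T` on `[0,1]` and of `a` on `{0, …, N}` matter. -/
structure PiecewiseMap where
  T : ℝ → ℝ
  N : ℕ
  a : ℕ → ℝ
  a_zero : a 0 = 0
  a_last : a N = 1
  a_lt : ∀ k < N, a k < a (k + 1)
  mapsTo : MapsTo T (Icc 0 1) (Icc 0 1)
  strictMonoOn : ∀ k < N, StrictMonoOn T (Ico (a k) (a (k + 1)))
  continuousOn : ∀ k < N, ContinuousOn T (Ico (a k) (a (k + 1)))
  /-- the last branch extends continuously to its right end point `1` -/
  continuous_one : ContinuousWithinAt T (Iio 1) 1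
  nonsingular : ∀ k < N, ∀ E : Set ℝ, MeasurableSet E → volume E = 0 →
    volume (Ico (a k) (a (k + 1)) ∩ T ⁻¹' E) = 0

/-- The cone of non-negative, non-increasing functions on `[0,1]`. -/
def coneJ : Set (ℝ → ℝ) := {f | (∀ x ∈ Icc (0 : ℝ) 1, 0 ≤ f x) ∧ AntitoneOn f (Icc 0 1)}

/-- The interval `[0,1]` in which every point `x` of `W` is replaced by two points
`x⁻ = (x, false)` and `x⁺ = (x, true)`; a point `x` outside `W` is `(x, true)`. -/
structure SplitInterval (W : Set ℝ) where
  /-- the projection to `[0,1]` -/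
  pt : ℝ
  /-- `false` exactly at the points `x⁻` -/
  tag : Bool
  pt_mem : pt ∈ Icc (0 : ℝ) 1
  mem_of_tag : tag = false → pt ∈ W

namespace SplitInterval

variable {W : Set ℝ}

/-- Lexicographic order: `y < x⁻ < x⁺ < z` whenever `y < x < z`. -/
instance : LinearOrder (SplitInterval W) :=
  LinearOrder.lift' (fun p => (toLex (p.pt, p.tag) : ℝ ×ₗ Bool)) (by
    rintro ⟨x, b, _, _⟩ ⟨y, c, _, _⟩ h
    obtain ⟨rfl, rfl⟩ := Prod.mk.inj (toLex.injective h)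
    rfl)

/-- The order topology. -/
instance : TopologicalSpace (SplitInterval W) := Preorder.topology (SplitInterval W)

instance : OrderTopology (SplitInterval W) := ⟨rfl⟩

instance : MeasurableSpace (SplitInterval W) := borel (SplitInterval W)

instance : BorelSpace (SplitInterval W) := ⟨rfl⟩

/-- `x⁺` for `x ∈ W`, and `x` for `x ∈ [0,1] \ W` (numbers outside `[0,1]`, which never occur
below, are moved to the nearest end point). -/
def plus (W : Set ℝ) (x : ℝ) : SplitInterval W where
  pt := projIcc (0 : ℝ) 1 zero_le_one x
  tag := true
  pt_mem := (projIcc (0 : ℝ) 1 zero_le_one x).2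
  mem_of_tag := fun h => Bool.noConfusion h

open Classical in
/-- `x⁻` for `x ∈ W`, and `x` for `x ∈ [0,1] \ W`. -/
def minus (W : Set ℝ) (x : ℝ) : SplitInterval W :=
  if h : x ∈ Icc (0 : ℝ) 1 ∧ x ∈ W then
    { pt := x, tag := false, pt_mem := h.1, mem_of_tag := fun _ => h.2 }
  else plus W x

end SplitInterval

namespace PiecewiseMap

variable (S : PiecewiseMap)

/-- The `k`-th branch interval. -/
def branch (k : ℕ) : Set ℝ := Ico (S.a k) (S.a (k + 1))

open Classical in
/-- The extended inverse `ψ` of the `k`-th branch. -/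
def psi (k : ℕ) (x : ℝ) : ℝ :=
  if x ≤ sInf (S.T '' S.branch k) then S.a k
  else if sSup (S.T '' S.branch k) ≤ x then S.a (k + 1)
  else Function.invFunOn S.T (S.branch k) x

/-- The sum of the first `k` extended inverses. -/
def psiSum (k : ℕ) (x : ℝ) : ℝ := ∑ i ∈ Finset.range k, S.psi i x

/-- `a`-convexity: `T'(0) > 1`, every branch has positive right derivative at its left end point,
and the sums of the first `k` extended inverses are differentiable off a countable set, with
non-increasing derivative. -/
structure IsAConvex : Prop where
  deriv_zero : ∃ d : ℝ, 1 < d ∧ HasDerivWithinAt S.T d (Ici 0) 0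
  deriv_left : ∀ k < S.N, ∃ d : ℝ, 0 < d ∧ HasDerivWithinAt S.T d (Ici (S.a k)) (S.a k)
  countable : ∀ k, 1 ≤ k → k ≤ S.N →
    {x ∈ Icc (0 : ℝ) 1 | ¬ DifferentiableWithinAt ℝ (S.psiSum k) (Icc 0 1) x}.Countable
  antitone : ∀ k, 1 ≤ k → k ≤ S.N →
    AntitoneOn (derivWithin (S.psiSum k) (Icc 0 1))
      {x ∈ Icc (0 : ℝ) 1 | DifferentiableWithinAt ℝ (S.psiSum k) (Icc 0 1) x}

open Classical in
/-- The derivative of `ψ`, in the version for which the (non-increasing) sums of the first `k`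
derivatives are upper semicontinuous: the left derivative, and the right derivative at `0`. -/
def dpsi (k : ℕ) (x : ℝ) : ℝ :=
  if x ≤ 0 then derivWithin (S.psi k) (Ici x) x else derivWithin (S.psi k) (Iic x) x

/-- Interior points where the two one-sided limits of the sum of the first `k` derivatives
differ. -/
def jumps (k : ℕ) : Set ℝ :=
  {x ∈ Ioo (0 : ℝ) 1 | Function.rightLim (fun y => ∑ i ∈ Finset.range k, S.dpsi i y) x ≠
    Function.leftLim (fun y => ∑ i ∈ Finset.range k, S.dpsi i y) x}

/-- All jumps, and the end points. -/
def V : Set ℝ := (⋃ k ∈ Finset.Icc 1 S.N, S.jumps k) ∪ {0, 1}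

/-- The points of `(0,1)` in some preimage of the forward orbit of `V`. -/
def W : Set ℝ :=
  (Icc (0 : ℝ) 1 ∩ ⋃ i : ℕ, S.T^[i] ⁻¹' (⋃ j : ℕ, S.T^[j] '' S.V)) \ {0, 1}

/-- The extension of `[0,1]` associated with the map. -/
abbrev X : Type := SplitInterval S.W

open Classical in
/-- The continuous extension of `T`: left limits at the points `x⁻` and at `1`. -/
def TX (p : S.X) : S.X :=
  if p.tag = false ∨ p.pt = 1 then SplitInterval.minus S.W (Function.leftLim S.T p.pt)
  else SplitInterval.plus S.W (S.T p.pt)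

open Classical in
/-- The continuous extension of `ψ`. -/
def psiX (k : ℕ) (p : S.X) : S.X :=
  if p.pt ≤ sInf (S.T '' S.branch k) then SplitInterval.plus S.W (S.a k)
  else if sSup (S.T '' S.branch k) ≤ p.pt then SplitInterval.minus S.W (S.a (k + 1))
  else if p.tag then SplitInterval.plus S.W (S.psi k p.pt)
  else SplitInterval.minus S.W (S.psi k p.pt)

open Classical in
/-- The continuous extension of the derivative of `ψ`: one-sided limits at `x⁻` and `x⁺`. -/
def dpsiX (k : ℕ) (p : S.X) : ℝ :=
  if p.pt ∈ S.W then
    if p.tag then Function.rightLim (S.dpsi k) p.pt else Function.leftLim (S.dpsi k) p.pt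
  else S.dpsi k p.pt

/-- The transfer operator `F_s f = ∑ (ψ')^s f ∘ ψ`. -/
def F (s : ℝ) (f : S.X → ℝ) (p : S.X) : ℝ :=
  ∑ k ∈ Finset.range S.N, S.dpsiX k p ^ s * f (S.psiX k p)

/-- The normalising constant `γ = ∫ F_s 1 dm`. -/
def gam (s : ℝ) (m : Measure S.X) : ℝ := ∫ p, S.F s (fun _ => 1) p ∂m

/-- `m` is a Borel probability measure fixed by `m ↦ F_s^* m / F_s^* m (1)`. -/
structure IsConformal (s : ℝ) (m : Measure S.X) : Prop where
  prob : IsProbabilityMeasure m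
  gam_pos : 0 < S.gam s m
  integral_eq : ∀ f : S.X → ℝ, Continuous f → ∫ p, S.F s f p ∂m = S.gam s m * ∫ p, f p ∂m

/-- The point `β`: the union of the iterates of the first branch interval is `[0,β]` up to its
right end point. -/
def beta : ℝ := sSup (⋃ i : ℕ, S.T^[i] '' Icc 0 (S.a 1))

/-- The cylinder of a word `d` of length `r`, as a subset of the extended interval. -/
def cylinder {r : ℕ} (d : Fin r → ℕ) : Set S.X :=
  {p | ∀ i : Fin r, S.TX^[i] p ∈
    Icc (SplitInterval.plus S.W (S.a (d i))) (SplitInterval.minus S.W (S.a (d i + 1)))}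

/-- Condition (B). The cylinders that contain `β`, `β⁺` or `β⁻` are exempt. -/
def CondB (s : ℝ) (m : Measure S.X) : Prop :=
  ∃ M : ℕ → ℝ, (∀ r, 0 < M r) ∧ Tendsto M atTop (𝓝 0) ∧
    ∀ (r : ℕ) (d : Fin r → ℕ), (∀ i, d i < S.N) →
      SplitInterval.plus S.W S.beta ∉ S.cylinder d → SplitInterval.minus S.W S.beta ∉ S.cylinder d →
      ⨅ n : ℕ, (⨆ p : S.X, |(S.F s)^[n] ((S.cylinder d).indicator fun _ => 1) p|) /
        S.gam s m ^ n ≤ M r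

/-- Condition (C). -/
def CondC (s : ℝ) : Prop :=
  ∀ k, 1 ≤ k → k ≤ S.N → (fun x => ∑ i ∈ Finset.range k, S.dpsi i x ^ s) ∈ coneJ

end PiecewiseMap

end

noncomputable section

namespace PiecewiseMap

variable (S : PiecewiseMap)

/-! The transfer operator `F` preserves the cone of non-negative non-increasing functions: by (C)
the partial sums of the weights decrease along the interval, while `f ∘ ψ_k` decreases in `k`, so
Abel summation applies (`F_antitone`). Conformality, extended from continuous to non-negative
measurable functions (`dualF_eq`), makes the functions `u_n = γ^{-n} F^n 1` (`iter`) non-increasing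
probability densities for `m`. Such a density is at most `1 / m (Iic p)` at `p` (`iter_le_inv`). If
the `u_n` are uniformly bounded on the support of `m`, then `g = limsup u_n` is non-increasing, `∫ g
≥ 1` by the reverse Fatou lemma, and `F g ≥ γ g` a.e. Both sides have the same integral, so `F g = γ
g` a.e., and `F ((f ∘ T) g) = f F g` turns this into invariance of the measure with density `g`, up
to normalisation.

By monotonicity the bound is needed only at the left end `c` of the support (`exists_iter_le`). It
is immediate if `c` is an atom. Otherwise `γ u_{n+1}(c) = ∑ ψ_k'(c)^s u_n(ψ_k c)`, and branches of
non-zero weight send `c` to points `≥ c`, since no mass lies to the left of `c`. Terms with `ψ_k c >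
c` are bounded by the inverse mass. At most one branch `i` fixes `c`, so `u_{n+1}(c) ≤ q u_n(c) + C`
with `q = ψ_i'(c)^s / γ`, and `q < 1` suffices.

Suppose `q ≥ 1`. If `c = 0`, the cylinders `0…0` lie to the left of `β`, and their normalised
iterates at `c` are at least `q^n ≥ 1`, against (B). If `c > 0`, concavity of the sums of inverse
branches shows that `T` maps `[0,c]` into itself (`T_le_left_end`), so `β ≤ c`. The branch `ψ_i`
maps short intervals to the right of `c` into themselves, whence `q ≤ 1` (`weight_le_gam`). Another
branch `j` of non-zero weight at `c` would give cylinders `j i…i` to the right of `β` violating (B)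
(`weight_eq_zero_of_gam_le`). Hence `u_{n+1}(c) = u_n(c)`. -/

lemma N_pos : 0 < S.N := by
  rcases Nat.eq_zero_or_pos S.N with h | h
  · have h1 := S.a_last
    rw [h, S.a_zero] at h1
    norm_num at h1
  · exact h

/-! ### Partition points and extended inverse branches -/

variable {S}

lemma a_le {i j : ℕ} (hij : i ≤ j) (hj : j ≤ S.N) : S.a i ≤ S.a j := by
  induction j, hij using Nat.le_induction with
  | base => exact le_rfl
  | succ n hn ih => exact (ih (by omega)).trans (S.a_lt n (by omega)).le

lemma a_strict {i j : ℕ} (hij : i < j) (hj : j ≤ S.N) : S.a i < S.a j :=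
  (S.a_lt i (by omega)).trans_le (a_le hij hj)

lemma a_nonneg {k : ℕ} (hk : k ≤ S.N) : 0 ≤ S.a k := by
  simpa [S.a_zero] using a_le (Nat.zero_le k) hk

lemma a_le_one {k : ℕ} (hk : k ≤ S.N) : S.a k ≤ 1 := by
  simpa [S.a_last] using a_le hk le_rfl

lemma left_mem_branch {k : ℕ} (hk : k < S.N) : S.a k ∈ S.branch k := ⟨le_rfl, S.a_lt k hk⟩

lemma branch_subset {k : ℕ} (hk : k < S.N) : S.branch k ⊆ Icc 0 1 := fun _ hx =>
  ⟨(a_nonneg hk.le).trans hx.1, hx.2.le.trans (a_le_one hk)⟩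

lemma exists_branch {x : ℝ} (h0 : 0 ≤ x) (h1 : x < 1) : ∃ k < S.N, x ∈ S.branch k := by
  have key : ∀ n ≤ S.N, x < S.a n → ∃ k < n, x ∈ S.branch k := by
    intro n
    induction n with
    | zero => intro _ h; rw [S.a_zero] at h; linarith
    | succ n ih =>
      intro hn h
      rcases lt_or_ge x (S.a n) with hx | hx
      · obtain ⟨k, hk, hk'⟩ := ih (by omega) hx
        exact ⟨k, by omega, hk'⟩
      · exact ⟨n, by omega, hx, h⟩
  exact key S.N le_rfl (by rwa [S.a_last])

lemma T_mem_of_branch {k : ℕ} (hk : k < S.N) {x : ℝ} (hx : x ∈ S.branch k) :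
    S.T x ∈ Icc (0 : ℝ) 1 := S.mapsTo (branch_subset hk hx)

variable (S) in
/-- The right end point of the image of the `k`-th branch. -/
def branchSup (k : ℕ) : ℝ := sSup (S.T '' S.branch k)

lemma sInf_image_branch {k : ℕ} (hk : k < S.N) : sInf (S.T '' S.branch k) = S.T (S.a k) := by
  have : IsLeast (S.T '' S.branch k) (S.T (S.a k)) := by
    refine ⟨⟨_, left_mem_branch hk, rfl⟩, ?_⟩
    rintro _ ⟨y, hy, rfl⟩
    exact (S.strictMonoOn k hk).monotoneOn (left_mem_branch hk) hy hy.1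
  exact this.csInf_eq

lemma bddAbove_image_branch {k : ℕ} (hk : k < S.N) : BddAbove (S.T '' S.branch k) :=
  ⟨1, by rintro _ ⟨y, hy, rfl⟩; exact (T_mem_of_branch hk hy).2⟩

lemma T_lt_branchSup {k : ℕ} (hk : k < S.N) {y : ℝ} (hy : y ∈ S.branch k) :
    S.T y < S.branchSup k := by
  obtain ⟨z, hz1, hz2⟩ := exists_between hy.2
  have hz : z ∈ S.branch k := ⟨hy.1.trans hz1.le, hz2⟩
  exact (S.strictMonoOn k hk hy hz hz1).trans_le
    (le_csSup (bddAbove_image_branch hk) ⟨z, hz, rfl⟩)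

lemma branchSup_le {k : ℕ} (hk : k < S.N) {x : ℝ} (h : ∀ y ∈ S.branch k, S.T y ≤ x) :
    S.branchSup k ≤ x :=
  csSup_le ⟨_, _, left_mem_branch hk, rfl⟩ (by rintro _ ⟨y, hy, rfl⟩; exact h y hy)

lemma branchSup_le_one {k : ℕ} (hk : k < S.N) : S.branchSup k ≤ 1 :=
  branchSup_le hk fun _ hy => (T_mem_of_branch hk hy).2

lemma exists_T_eq {k : ℕ} (hk : k < S.N) {x : ℝ} (h1 : S.T (S.a k) ≤ x)
    (h2 : x < S.branchSup k) : ∃ y ∈ S.branch k, S.T y = x := by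
  obtain ⟨_, ⟨z, hz, rfl⟩, hxz⟩ := exists_lt_of_lt_csSup
    (⟨_, _, left_mem_branch hk, rfl⟩ : (S.T '' S.branch k).Nonempty) h2
  have hsub : Icc (S.a k) z ⊆ S.branch k := fun u hu => ⟨hu.1, hu.2.trans_lt hz.2⟩
  obtain ⟨y, hy, hyx⟩ := intermediate_value_Icc hz.1 ((S.continuousOn k hk).mono hsub)
    ⟨h1, hxz.le⟩
  exact ⟨y, hsub hy, hyx⟩

lemma psi_of_le {k : ℕ} (hk : k < S.N) {x : ℝ} (h : x ≤ S.T (S.a k)) : S.psi k x = S.a k := by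
  rw [psi, if_pos (by rwa [sInf_image_branch hk])]

lemma psi_of_ge {k : ℕ} (hk : k < S.N) {x : ℝ} (h : S.branchSup k ≤ x) :
    S.psi k x = S.a (k + 1) := by
  have h1 := T_lt_branchSup hk (left_mem_branch hk)
  rw [psi, if_neg (by rw [sInf_image_branch hk]; linarith),
    if_pos (by exact h)]

lemma psi_T {k : ℕ} (hk : k < S.N) {y : ℝ} (hy : y ∈ S.branch k) : S.psi k (S.T y) = y := by
  rcases eq_or_lt_of_le hy.1 with h | h
  · rw [← h]; exact psi_of_le hk le_rfl
  · have h1 := S.strictMonoOn k hk (left_mem_branch hk) hy h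
    have h2 := T_lt_branchSup hk hy
    rw [psi, if_neg (by rw [sInf_image_branch hk]; linarith), if_neg (by
      change ¬ S.branchSup k ≤ _; linarith)]
    have hex : ∃ z ∈ S.branch k, S.T z = S.T y := ⟨y, hy, rfl⟩
    exact (S.strictMonoOn k hk).injOn (Function.invFunOn_mem hex) hy (Function.invFunOn_eq hex)

/-- The three regimes of the extended inverse. -/
lemma psi_cases {k : ℕ} (hk : k < S.N) (x : ℝ) :
    (x ≤ S.T (S.a k) ∧ S.psi k x = S.a k) ∨ (S.branchSup k ≤ x ∧ S.psi k x = S.a (k + 1)) ∨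
      (S.T (S.a k) < x ∧ x < S.branchSup k ∧ S.psi k x ∈ Ioo (S.a k) (S.a (k + 1)) ∧
        S.T (S.psi k x) = x) := by
  rcases le_or_gt x (S.T (S.a k)) with h | h
  · exact Or.inl ⟨h, psi_of_le hk h⟩
  rcases le_or_gt (S.branchSup k) x with h' | h'
  · exact Or.inr (Or.inl ⟨h', psi_of_ge hk h'⟩)
  · obtain ⟨y, hy, rfl⟩ := exists_T_eq hk h.le h'
    refine Or.inr (Or.inr ⟨h, h', ?_⟩)
    rw [psi_T hk hy]
    exact ⟨⟨lt_of_le_of_ne hy.1 (by rintro rfl; exact lt_irrefl _ h), hy.2⟩, rfl⟩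

lemma psi_mem {k : ℕ} (hk : k < S.N) (x : ℝ) : S.psi k x ∈ Icc (S.a k) (S.a (k + 1)) := by
  have := S.a_lt k hk
  rcases psi_cases hk x with ⟨_, h⟩ | ⟨_, h⟩ | ⟨_, _, h, _⟩
  · rw [h]; exact ⟨le_rfl, this.le⟩
  · rw [h]; exact ⟨this.le, le_rfl⟩
  · exact ⟨h.1.le, h.2.le⟩

lemma psi_mono {k : ℕ} (hk : k < S.N) : Monotone (S.psi k) := by
  intro x y hxy
  rcases psi_cases hk x with ⟨_, h⟩ | ⟨h', h⟩ | ⟨h1, h2, h3, h4⟩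
  · rw [h]; exact (psi_mem hk y).1
  · rw [h, psi_of_ge hk (h'.trans hxy)]
  · rcases psi_cases hk y with ⟨h', h⟩ | ⟨h', h⟩ | ⟨h1', h2', h3', h4'⟩
    · linarith
    · rw [h]; exact h3.2.le
    · by_contra! hlt
      have := S.strictMonoOn k hk ⟨h3'.1.le, h3'.2⟩ ⟨h3.1.le, h3.2⟩ hlt
      linarith

lemma psi_of_one_le {k : ℕ} (hk : k < S.N) {x : ℝ} (h : 1 ≤ x) : S.psi k x = S.a (k + 1) :=
  psi_of_ge hk ((branchSup_le_one hk).trans h)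

/-- A monotone map onto the interval `[a k, a (k+1)]` cannot jump. -/
lemma psi_continuous {k : ℕ} (hk : k < S.N) : Continuous (S.psi k) := by
  let f : ℝ → Icc (S.a k) (S.a (k + 1)) := fun x => ⟨S.psi k x, psi_mem hk x⟩
  have hf : Monotone f := fun x y h => psi_mono hk h
  have hsurj : Function.Surjective f := by
    rintro ⟨y, hy⟩
    rcases eq_or_lt_of_le hy.2 with h | h
    · exact ⟨1, Subtype.ext (by simp only [f]; rw [psi_of_one_le hk le_rfl, h])⟩
    · exact ⟨S.T y, Subtype.ext (psi_T hk ⟨hy.1, h⟩)⟩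
  exact continuous_subtype_val.comp (hf.continuous_of_surjective hsurj)

lemma psiSum_continuous {k : ℕ} (hk : k ≤ S.N) : Continuous (S.psiSum k) :=
  continuous_finsetSum _ fun _ hi => psi_continuous ((Finset.mem_range.1 hi).trans_le hk)

lemma psiSum_mono {k : ℕ} (hk : k ≤ S.N) : Monotone (S.psiSum k) := fun _ _ h =>
  Finset.sum_le_sum fun _ hi => psi_mono ((Finset.mem_range.1 hi).trans_le hk) h

lemma psiSum_succ (k : ℕ) (x : ℝ) : S.psiSum (k + 1) x = S.psiSum k x + S.psi k x :=
  Finset.sum_range_succ _ _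

end PiecewiseMap

/-! ### Concavity from a derivative that decreases off a countable set -/

/-- Mean value inequalities for a continuous function which is differentiable with bounded
derivative off a countable set. -/
lemma mul_sub_le_and_le_mul_sub_of_deriv_off_countable {f : ℝ → ℝ} (hf : Continuous f) {C : Set ℝ}
    (hC : C.Countable) {a b m M : ℝ} (hab : a ≤ b)
    (hd : ∀ u ∈ Ioo a b \ C, DifferentiableAt ℝ f u)
    (hm : ∀ u ∈ Ioo a b \ C, m ≤ deriv f u) (hM : ∀ u ∈ Ioo a b \ C, deriv f u ≤ M) :
    m * (b - a) ≤ f b - f a ∧ f b - f a ≤ M * (b - a) := by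
  have hae : ∀ᵐ u ∂(volume.restrict (Ioo a b)), u ∈ Ioo a b \ C := by
    filter_upwards [ae_restrict_mem measurableSet_Ioo,
      ae_restrict_of_ae (hC.ae_notMem volume)] with u h1 h2 using ⟨h1, h2⟩
  have hint : IntervalIntegrable (deriv f) volume a b := by
    rw [intervalIntegrable_iff_integrableOn_Ioo_of_le hab]
    refine Measure.integrableOn_of_bounded (M := max |m| |M|) (by simp)
      (measurable_deriv f).aestronglyMeasurable ?_
    filter_upwards [hae] with u hu
    rw [Real.norm_eq_abs]
    exact abs_le_max_abs_abs (hm u hu) (hM u hu)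
  have heq := integral_eq_of_hasDerivAt_off_countable_of_le f (deriv f) hab hC hf.continuousOn
    (fun u hu => (hd u hu).hasDerivAt) hint
  rw [Measure.restrict_congr_set Ioo_ae_eq_Icc] at hae
  have h1 := intervalIntegral.integral_mono_ae_restrict hab
    (intervalIntegrable_const (c := m)) hint
    (by filter_upwards [hae] with u hu using hm u hu)
  have h2 := intervalIntegral.integral_mono_ae_restrict hab hint
    (intervalIntegrable_const (c := M))
    (by filter_upwards [hae] with u hu using hM u hu)
  rw [intervalIntegral.integral_const, smul_eq_mul] at h1 h2
  rw [← heq]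
  constructor <;> linarith

lemma exists_mem_Ioo_notMem_of_countable {C : Set ℝ} (hC : C.Countable) {a b : ℝ} (hab : a < b) :
    ∃ u ∈ Ioo a b, u ∉ C := by
  by_contra! h
  exact (Cardinal.Real.Ioo_countable_iff.not.2 (not_le.2 hab)) (hC.mono h)

/-- A continuous function on a half-line, whose derivative exists and decreases off a countable
set, is concave. -/
lemma concaveOn_Ici_of_deriv_antitoneOn {f : ℝ → ℝ} (hf : Continuous f) {C : Set ℝ}
    (hC : C.Countable) (hd : ∀ u ∈ Ioi 0 \ C, DifferentiableAt ℝ f u)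
    (ha : AntitoneOn (deriv f) (Ioi 0 \ C)) : ConcaveOn ℝ (Ici 0) f := by
  refine concaveOn_of_slope_anti_adjacent (convex_Ici 0) ?_
  intro x y z hx _ hxy hyz
  have hx0 : (0 : ℝ) ≤ x := hx
  obtain ⟨v, hv, hvC⟩ := exists_mem_Ioo_notMem_of_countable hC (show z < z + 1 by linarith)
  obtain ⟨v', hv', hvC'⟩ := exists_mem_Ioo_notMem_of_countable hC hyz
  obtain ⟨w, hw, hwC⟩ := exists_mem_Ioo_notMem_of_countable hC hxy
  -- The supremum of the derivatives to the right of `y` separates the slopes over `[y, z]` from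
  -- those over `[x, y]`.
  let A := deriv f '' (Ioi y \ C)
  have hbd : ∀ u ∈ Ioc 0 y \ C, deriv f u ∈ upperBounds A := by
    rintro u ⟨hu, huC⟩ _ ⟨t, ⟨ht, htC⟩, rfl⟩
    have ht' : y < t := ht
    exact ha ⟨hu.1, huC⟩ ⟨(by linarith [hu.1, hu.2] : (0 : ℝ) < t), htC⟩ (hu.2.trans ht'.le)
  have hbdd : BddAbove A := ⟨_, hbd w ⟨⟨by linarith [hw.1], hw.2.le⟩, hwC⟩⟩
  have hne : A.Nonempty := ⟨_, v', ⟨hv'.1, hvC'⟩, rfl⟩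
  have h1 : f z - f y ≤ sSup A * (z - y) := by
    refine (mul_sub_le_and_le_mul_sub_of_deriv_off_countable hf hC hyz.le (m := deriv f v)
      ?_ ?_ ?_).2
    · exact fun u hu => hd u ⟨(by linarith [hu.1.1] : (0 : ℝ) < u), hu.2⟩
    · exact fun u hu => ha ⟨(by linarith [hu.1.1] : (0 : ℝ) < u), hu.2⟩
        ⟨(by linarith [hv.1] : (0 : ℝ) < v), hvC⟩ (by linarith [hu.1.2, hv.1])
    · exact fun u hu => le_csSup hbdd ⟨u, ⟨hu.1.1, hu.2⟩, rfl⟩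
  -- The left end `x` may be `0`, near which the derivative need not be bounded. For `t > x` a good
  -- point in `(x, t)` supplies the upper bound, and `t → x` follows by continuity.
  have h2 : ∀ t ∈ Ioo x y, sSup A * (y - t) ≤ f y - f t := by
    intro t ht
    obtain ⟨p, hp, hpC⟩ := exists_mem_Ioo_notMem_of_countable hC ht.1
    refine (mul_sub_le_and_le_mul_sub_of_deriv_off_countable hf hC ht.2.le (M := deriv f p)
      ?_ ?_ ?_).1
    · exact fun u hu => hd u ⟨(by linarith [hu.1.1, ht.1] : (0 : ℝ) < u), hu.2⟩
    · exact fun u hu => csSup_le hne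
        (hbd u ⟨⟨by linarith [hu.1.1, ht.1], hu.1.2.le⟩, hu.2⟩)
    · exact fun u hu => ha ⟨(by linarith [hp.1] : (0 : ℝ) < p), hpC⟩
        ⟨(by linarith [hu.1.1, ht.1] : (0 : ℝ) < u), hu.2⟩ (by linarith [hu.1.1, hp.2])
  have h3 : sSup A * (y - x) ≤ f y - f x := by
    have hc1 : Tendsto (fun t => sSup A * (y - t)) (𝓝[>] x) (𝓝 (sSup A * (y - x))) :=
      (Continuous.tendsto (by fun_prop) x).mono_left nhdsWithin_le_nhds
    have hc2 : Tendsto (fun t => f y - f t) (𝓝[>] x) (𝓝 (f y - f x)) :=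
      (Continuous.tendsto (by fun_prop) x).mono_left nhdsWithin_le_nhds
    refine le_of_tendsto_of_tendsto hc1 hc2 ?_
    filter_upwards [Ioo_mem_nhdsGT hxy] with t ht using h2 t ht
  calc (f z - f y) / (z - y) ≤ sSup A := (div_le_iff₀ (by linarith)).2 h1
    _ ≤ _ := (le_div_iff₀ (by linarith)).2 h3

/-- The left derivative of a concave function is at least the slopes to the right. -/
lemma ConcaveOn.slope_le_of_hasDerivWithinAt_left {f : ℝ → ℝ} (hf : ConcaveOn ℝ (Ici 0) f)
    {x y f' : ℝ} (hx : 0 < x) (hxy : x < y) (h : HasDerivWithinAt f f' (Iic x) x) :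
    f y - f x ≤ f' * (y - x) := by
  have h' := hasDerivWithinAt_Iio_iff_Iic.2 h
  rw [hasDerivWithinAt_iff_tendsto_slope' (by simp)] at h'
  have : (f y - f x) / (y - x) ≤ f' := by
    refine ge_of_tendsto h' ?_
    filter_upwards [Ioo_mem_nhdsLT hx] with w hw
    have := hf.slope_anti_adjacent (show (0 : ℝ) ≤ w from hw.1.le)
      (show (0 : ℝ) ≤ y by linarith) hw.2 hxy
    rwa [slope_comm, slope_def_field]
  rwa [div_le_iff₀ (by linarith)] at this

lemma ConcaveOn.exists_hasDerivWithinAt_left {f : ℝ → ℝ} (hf : ConcaveOn ℝ (Ici 0) f)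
    {x : ℝ} (hx : 0 < x) : ∃ f', HasDerivWithinAt f f' (Iic x) x := by
  have h := hf.neg.hasDerivWithinAt_leftDeriv_of_mem_interior (x := x) (by simpa using hx)
  have h2 := h.neg
  simp only [neg_neg] at h2
  exact ⟨_, hasDerivWithinAt_Iio_iff_Iic.1 (by simpa [Pi.neg_def] using h2)⟩

/-! ### Concavity of the sums of inverse branches -/

namespace PiecewiseMap

variable {S : PiecewiseMap}

lemma psiSum_of_one_le {k : ℕ} (hk : k ≤ S.N) {x : ℝ} (hx : 1 ≤ x) :
    S.psiSum k x = ∑ i ∈ Finset.range k, S.a (i + 1) :=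
  Finset.sum_congr rfl fun _ hi => psi_of_one_le ((Finset.mem_range.1 hi).trans_le hk) hx

/-- Beyond `1` the sums are constant, and their derivative `0` is below the non-negative derivatives
on `[0,1]`. Concavity therefore holds on all of `[0, ∞)`, which makes `1` an interior point. -/
lemma psiSum_concave (hS : S.IsAConvex) {k : ℕ} (hk : k ≤ S.N) :
    ConcaveOn ℝ (Ici 0) (S.psiSum k) := by
  rcases Nat.eq_zero_or_pos k with rfl | hk0
  · have : S.psiSum 0 = fun _ => 0 := by ext x; simp [psiSum]
    rw [this]
    exact concaveOn_const 0 (convex_Ici 0)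
  set G := {x ∈ Icc (0 : ℝ) 1 | DifferentiableWithinAt ℝ (S.psiSum k) (Icc 0 1) x} with hG
  let C := {x ∈ Icc (0 : ℝ) 1 | ¬ DifferentiableWithinAt ℝ (S.psiSum k) (Icc 0 1) x} ∪ {1}
  have hC : C.Countable := (hS.countable k hk0 hk).union (countable_singleton 1)
  have hlow : ∀ u ∈ Ioi 0 \ C, u ≤ 1 → u ∈ G ∧ Icc (0 : ℝ) 1 ∈ 𝓝 u := by
    intro u hu hu1
    have hu0 : (0 : ℝ) < u := hu.1
    have hne : u ≠ 1 := fun h => hu.2 (Or.inr h)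
    refine ⟨⟨⟨hu0.le, hu1⟩, ?_⟩, Icc_mem_nhds hu0 (lt_of_le_of_ne hu1 hne)⟩
    by_contra h
    exact hu.2 (Or.inl ⟨⟨hu0.le, hu1⟩, h⟩)
  have hhigh : ∀ u : ℝ, 1 < u → HasDerivAt (S.psiSum k) 0 u := by
    intro u hu
    refine (hasDerivAt_const u (∑ i ∈ Finset.range k, S.a (i + 1))).congr_of_eventuallyEq ?_
    filter_upwards [Ioi_mem_nhds hu] with v hv using psiSum_of_one_le hk (le_of_lt hv)
  refine concaveOn_Ici_of_deriv_antitoneOn (psiSum_continuous hk) hC ?_ ?_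
  · intro u hu
    rcases le_or_gt u 1 with h | h
    · exact (hlow u hu h).1.2.differentiableAt (hlow u hu h).2
    · exact (hhigh u h).differentiableAt
  · intro u hu v hv huv
    rcases le_or_gt v 1 with h | h
    · have h1 := hlow u hu (huv.trans h)
      have h2 := hlow v hv h
      rw [← derivWithin_of_mem_nhds h1.2, ← derivWithin_of_mem_nhds h2.2]
      exact hS.antitone k hk0 hk h1.1 h2.1 huv
    · rw [(hhigh v h).deriv]
      exact (psiSum_mono hk).deriv_nonneg

/-- The derivative of an inverse branch at the left end point of its image. -/
lemma hasDerivWithinAt_psi {k : ℕ} (hk : k < S.N) {d : ℝ} (hd : 0 < d)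
    (h : HasDerivWithinAt S.T d (Ici (S.a k)) (S.a k)) :
    HasDerivWithinAt (S.psi k) d⁻¹ (Ici (S.T (S.a k))) (S.T (S.a k)) := by
  rw [← hasDerivWithinAt_Ioi_iff_Ici, hasDerivWithinAt_iff_tendsto_slope' (by simp)] at h ⊢
  have hlt := T_lt_branchSup hk (left_mem_branch hk)
  have h1 : Tendsto (S.psi k) (𝓝[>] S.T (S.a k)) (𝓝[>] S.a k) := by
    refine tendsto_nhdsWithin_iff.2 ⟨?_, ?_⟩
    · have := (psi_continuous hk).tendsto (S.T (S.a k))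
      rw [psi_of_le hk le_rfl] at this
      exact this.mono_left nhdsWithin_le_nhds
    · filter_upwards [Ioo_mem_nhdsGT hlt] with x hx
      rcases psi_cases hk x with ⟨h, _⟩ | ⟨h, _⟩ | ⟨_, _, h, _⟩
      · exact absurd hx.1 (not_lt.2 h)
      · exact absurd hx.2 (not_lt.2 h)
      · exact h.1
  refine ((h.comp h1).inv₀ hd.ne').congr' ?_
  filter_upwards [Ioo_mem_nhdsGT hlt] with x hx
  rcases psi_cases hk x with ⟨h, _⟩ | ⟨h, _⟩ | ⟨_, _, _, h⟩
  · exact absurd hx.1 (not_lt.2 h)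
  · exact absurd hx.2 (not_lt.2 h)
  · simp only [Function.comp, slope_def_field, h, inv_div, psi_of_le hk le_rfl]

/-- A single branch is a difference of two concave sums, so the left derivative exists and `dpsi` is
not a default value. -/
lemma hasDerivWithinAt_dpsi_left (hS : S.IsAConvex) {k : ℕ} (hk : k < S.N) {x : ℝ} (hx : 0 < x) :
    HasDerivWithinAt (S.psi k) (S.dpsi k x) (Iic x) x := by
  obtain ⟨u, hu⟩ := (psiSum_concave hS hk).exists_hasDerivWithinAt_left hx
  obtain ⟨v, hv⟩ := (psiSum_concave hS hk.le).exists_hasDerivWithinAt_left hx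
  have h : HasDerivWithinAt (S.psi k) (u - v) (Iic x) x := by
    have := hu.sub hv
    refine this.congr_of_eventuallyEq (Eventually.of_forall fun y => ?_) ?_ <;>
      simp [psiSum_succ]
  rw [dpsi, if_neg (not_le.2 hx)]
  exact h.differentiableWithinAt.hasDerivWithinAt

/-- Concavity does not make the derivative at the boundary point `0` finite. If `T (a k) = 0`, it is
the inverse of the right derivative of `T` at `a k`; otherwise the branch is constant near `0`. -/
lemma hasDerivWithinAt_dpsi_zero (hS : S.IsAConvex) {k : ℕ} (hk : k < S.N) :
    HasDerivWithinAt (S.psi k) (S.dpsi k 0) (Ici 0) 0 := by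
  have key : DifferentiableWithinAt ℝ (S.psi k) (Ici 0) 0 := by
    rcases eq_or_lt_of_le (T_mem_of_branch hk (left_mem_branch hk)).1 with h | h
    · obtain ⟨d, hd, hd'⟩ := hS.deriv_left k hk
      have := hasDerivWithinAt_psi hk hd hd'
      rw [← h] at this
      exact this.differentiableWithinAt
    · refine ((hasDerivAt_const (0 : ℝ) (S.a k)).congr_of_eventuallyEq
        ?_).differentiableAt.differentiableWithinAt
      filter_upwards [Iio_mem_nhds h] with y hy using psi_of_le hk (le_of_lt hy)
  rw [dpsi, if_pos le_rfl]
  exact key.hasDerivWithinAt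

variable (S) in
/-- The sum of the first `k` derivatives of extended inverses. -/
def dpsiSum (k : ℕ) (x : ℝ) : ℝ := ∑ i ∈ Finset.range k, S.dpsi i x

lemma dpsiSum_succ (k : ℕ) (x : ℝ) : S.dpsiSum (k + 1) x = S.dpsiSum k x + S.dpsi k x :=
  Finset.sum_range_succ _ _

/-- This chord estimate and `le_psiSum_sub` carry concavity into the rest of the argument. -/
lemma psiSum_sub_le (hS : S.IsAConvex) {k : ℕ} (hk : k ≤ S.N) {x y : ℝ} (hx : 0 ≤ x)
    (hxy : x < y) : S.psiSum k y - S.psiSum k x ≤ S.dpsiSum k x * (y - x) := by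
  have hc := psiSum_concave hS hk
  rcases hx.eq_or_lt with rfl | hx
  · have h : HasDerivWithinAt (S.psiSum k) (S.dpsiSum k 0) (Ici 0) 0 :=
      HasDerivWithinAt.fun_sum fun i hi =>
        hasDerivWithinAt_dpsi_zero hS ((Finset.mem_range.1 hi).trans_le hk)
    have := hc.slope_le_of_hasDerivWithinAt (by simp) (show (0 : ℝ) ≤ y from hxy.le) hxy h
    rwa [slope_def_field, div_le_iff₀ (by linarith)] at this
  · exact hc.slope_le_of_hasDerivWithinAt_left hx hxy <| HasDerivWithinAt.fun_sum fun i hi =>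
      hasDerivWithinAt_dpsi_left hS ((Finset.mem_range.1 hi).trans_le hk) hx

lemma le_psiSum_sub (hS : S.IsAConvex) {k : ℕ} (hk : k ≤ S.N) {x y : ℝ} (hx : 0 ≤ x)
    (hxy : x < y) : S.dpsiSum k y * (y - x) ≤ S.psiSum k y - S.psiSum k x := by
  have hy : 0 < y := hx.trans_lt hxy
  have h : HasDerivWithinAt (S.psiSum k) (S.dpsiSum k y) (Iic y) y :=
    HasDerivWithinAt.fun_sum fun i hi =>
      hasDerivWithinAt_dpsi_left hS ((Finset.mem_range.1 hi).trans_le hk) hy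
  have := (psiSum_concave hS hk).le_slope_of_hasDerivWithinAt_Iio (show (0 : ℝ) ≤ x from hx)
    (show (0 : ℝ) ≤ y from hy.le) hxy (hasDerivWithinAt_Iio_iff_Iic.2 h)
  rwa [slope_def_field, le_div_iff₀ (by linarith)] at this

lemma dpsiSum_antitoneOn (hS : S.IsAConvex) {k : ℕ} (hk : k ≤ S.N) :
    AntitoneOn (S.dpsiSum k) (Ici 0) := by
  intro x hx y _ hxy
  rcases hxy.eq_or_lt with rfl | hxy
  · exact le_rfl
  · exact le_of_mul_le_mul_right ((le_psiSum_sub hS hk hx hxy).trans (psiSum_sub_le hS hk hx hxy))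
      (by linarith)

lemma dpsi_nonneg {k : ℕ} (hk : k < S.N) (x : ℝ) : 0 ≤ S.dpsi k x := by
  rw [dpsi]
  split_ifs
  · exact ((psi_mono hk).monotoneOn _).derivWithin_nonneg
  · exact ((psi_mono hk).monotoneOn _).derivWithin_nonneg

lemma dpsi_eq_zero_of_lt {k : ℕ} (hk : k < S.N) {x : ℝ} (hx : x < S.T (S.a k)) :
    S.dpsi k x = 0 := by
  have h : HasDerivAt (S.psi k) 0 x := by
    refine (hasDerivAt_const x (S.a k)).congr_of_eventuallyEq ?_
    filter_upwards [Iio_mem_nhds hx] with y hy using psi_of_le hk (le_of_lt hy)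
  rw [dpsi]
  split_ifs
  · exact h.hasDerivWithinAt.derivWithin (uniqueDiffWithinAt_Ici x)
  · exact h.hasDerivWithinAt.derivWithin (uniqueDiffWithinAt_Iic x)

lemma dpsi_eq_zero_of_gt {k : ℕ} (hk : k < S.N) {x : ℝ} (hx : S.branchSup k < x) :
    S.dpsi k x = 0 := by
  have h : HasDerivAt (S.psi k) 0 x := by
    refine (hasDerivAt_const x (S.a (k + 1))).congr_of_eventuallyEq ?_
    filter_upwards [Ioi_mem_nhds hx] with y hy using psi_of_ge hk (le_of_lt hy)
  rw [dpsi]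
  split_ifs
  · exact h.hasDerivWithinAt.derivWithin (uniqueDiffWithinAt_Ici x)
  · exact h.hasDerivWithinAt.derivWithin (uniqueDiffWithinAt_Iic x)

end PiecewiseMap

/-! ### One-sided limits of non-increasing functions on a half-line -/

section OneSidedLimits

variable {f : ℝ → ℝ} {x : ℝ}

/-- Precomposing with `max · 0` gives a function monotone on the whole line and unchanged near
positive points. -/
lemma AntitoneOn.comp_max_zero (hf : AntitoneOn f (Ici 0)) : Antitone fun y => f (max y 0) :=
  fun _ _ h => hf (mem_Ici.2 (le_max_right _ _)) (mem_Ici.2 (le_max_right _ _)) (max_le_max_right 0 h)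

lemma eventuallyEq_comp_max_zero (f : ℝ → ℝ) (hx : 0 < x) :
    f =ᶠ[𝓝 x] fun y => f (max y 0) := by
  filter_upwards [Ioi_mem_nhds hx] with y hy
  rw [max_eq_left (le_of_lt hy)]

lemma AntitoneOn.tendsto_leftLim_of_pos (hf : AntitoneOn f (Ici 0)) (hx : 0 < x) :
    Tendsto f (𝓝[<] x) (𝓝 (Function.leftLim f x)) :=
  tendsto_leftLim_of_tendsto ⟨_, (hf.comp_max_zero.tendsto_leftLim x).congr'
    ((eventuallyEq_comp_max_zero f hx).filter_mono nhdsWithin_le_nhds).symm⟩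

lemma AntitoneOn.tendsto_rightLim_of_pos (hf : AntitoneOn f (Ici 0)) (hx : 0 < x) :
    Tendsto f (𝓝[>] x) (𝓝 (Function.rightLim f x)) :=
  tendsto_rightLim_of_tendsto ⟨_, (hf.comp_max_zero.tendsto_rightLim x).congr'
    ((eventuallyEq_comp_max_zero f hx).filter_mono nhdsWithin_le_nhds).symm⟩

lemma AntitoneOn.continuousAt_of_rightLim_eq_leftLim (hf : AntitoneOn f (Ici 0)) (hx : 0 < x)
    (h : Function.rightLim f x = Function.leftLim f x) : ContinuousAt f x := by
  have hev := eventuallyEq_comp_max_zero f hx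
  have h1 := (hf.tendsto_leftLim_of_pos hx).congr' (hev.filter_mono nhdsWithin_le_nhds)
  have h2 := (hf.tendsto_rightLim_of_pos hx).congr' (hev.filter_mono nhdsWithin_le_nhds)
  have : ContinuousAt (fun y => f (max y 0)) x := by
    rw [hf.comp_max_zero.continuousAt_iff_leftLim_eq_rightLim, leftLim_eq_of_tendsto h1,
      rightLim_eq_of_tendsto h2, h]
  exact this.congr hev.symm

end OneSidedLimits

/-! ### Jumps of the derivatives, the point `β`, and the set `W` -/

namespace PiecewiseMap

variable {S : PiecewiseMap}

lemma continuousAt_dpsiSum (hS : S.IsAConvex) {k : ℕ} (hk : k ≤ S.N) {x : ℝ} (hx : x ∈ Ioo 0 1)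
    (hV : x ∉ S.V) : ContinuousAt (S.dpsiSum k) x := by
  rcases Nat.eq_zero_or_pos k with rfl | hk0
  · exact continuousAt_const.congr (Eventually.of_forall fun y => by simp [dpsiSum] : (fun _ => (0 : ℝ)) =ᶠ[𝓝 x] _)
  refine (dpsiSum_antitoneOn hS hk).continuousAt_of_rightLim_eq_leftLim hx.1 ?_
  by_contra h
  exact hV (Or.inl (mem_iUnion₂.2 ⟨k, Finset.mem_Icc.2 ⟨hk0, hk⟩, hx, h⟩))

lemma dpsi_eq_sub (k : ℕ) : S.dpsi k = fun x => S.dpsiSum (k + 1) x - S.dpsiSum k x := by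
  ext x; rw [dpsiSum_succ]; ring

lemma tendsto_leftLim_dpsi (hS : S.IsAConvex) {k : ℕ} (hk : k < S.N) {x : ℝ} (hx : 0 < x) :
    Tendsto (S.dpsi k) (𝓝[<] x) (𝓝 (Function.leftLim (S.dpsi k) x)) := by
  have h := ((dpsiSum_antitoneOn hS hk).tendsto_leftLim_of_pos hx).sub
    ((dpsiSum_antitoneOn hS hk.le).tendsto_leftLim_of_pos hx)
  exact tendsto_leftLim_of_tendsto ⟨_, h.congr fun y => by rw [dpsi_eq_sub]⟩

lemma tendsto_rightLim_dpsi (hS : S.IsAConvex) {k : ℕ} (hk : k < S.N) {x : ℝ} (hx : 0 < x) :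
    Tendsto (S.dpsi k) (𝓝[>] x) (𝓝 (Function.rightLim (S.dpsi k) x)) := by
  have h := ((dpsiSum_antitoneOn hS hk).tendsto_rightLim_of_pos hx).sub
    ((dpsiSum_antitoneOn hS hk.le).tendsto_rightLim_of_pos hx)
  exact tendsto_rightLim_of_tendsto ⟨_, h.congr fun y => by rw [dpsi_eq_sub]⟩

lemma continuousAt_dpsi (hS : S.IsAConvex) {k : ℕ} (hk : k < S.N) {x : ℝ} (hx : x ∈ Ioo 0 1)
    (hV : x ∉ S.V) : ContinuousAt (S.dpsi k) x := by
  rw [dpsi_eq_sub]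
  exact (continuousAt_dpsiSum hS hk hx hV).sub (continuousAt_dpsiSum hS hk.le hx hV)

/-- Beyond the images of the first `j` branches, the sum of the first `j` extended inverses is
constant. -/
lemma psiSum_eq_of_image_le {j : ℕ} (hj : j ≤ S.N) {x z : ℝ}
    (h : ∀ i < j, ∀ y ∈ S.branch i, S.T y ≤ x) (hz : x ≤ z) :
    S.psiSum j z = ∑ i ∈ Finset.range j, S.a (i + 1) := by
  refine Finset.sum_congr rfl fun i hi => ?_
  rw [Finset.mem_range] at hi
  exact psi_of_ge (hi.trans_le hj) ((branchSup_le (hi.trans_le hj) (h i hi)).trans hz)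

/-- Otherwise the first `j + 1` inverse branches are all constant on `[x, T (a j)]`, while just
beyond `T (a j)` the branch `j` increases. A concave function cannot be flat and then increase. -/
lemma T_left_le (hS : S.IsAConvex) {j : ℕ} (hj : j < S.N) {x : ℝ} (hx : 0 ≤ x)
    (h : ∀ i < j, ∀ y ∈ S.branch i, S.T y ≤ x) : S.T (S.a j) ≤ x := by
  by_contra! hlt
  obtain ⟨y, hy1, hy2⟩ := exists_between (S.a_lt j hj)
  have hy : y ∈ S.branch j := ⟨hy1.le, hy2⟩
  have hT := S.strictMonoOn j hj (left_mem_branch hj) hy hy1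
  have h1 := le_psiSum_sub hS (Nat.succ_le_of_lt hj) hx hlt
  have h2 := psiSum_sub_le hS (Nat.succ_le_of_lt hj) (hx.trans hlt.le) hT
  simp only [Nat.succ_eq_add_one, psiSum_succ, psiSum_eq_of_image_le hj.le h le_rfl,
    psiSum_eq_of_image_le hj.le h hlt.le, psiSum_eq_of_image_le hj.le h (hlt.le.trans hT.le),
    psi_of_le hj hlt.le, psi_of_le hj le_rfl, psi_T hj hy] at h1 h2
  have h3 : S.dpsiSum (j + 1) (S.T (S.a j)) ≤ 0 := by
    by_contra! h4
    nlinarith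
  nlinarith

lemma T_zero (hS : S.IsAConvex) : S.T 0 = 0 := by
  have h := T_left_le hS S.N_pos le_rfl (fun i hi => absurd hi (Nat.not_lt_zero i))
  rw [S.a_zero] at h
  exact le_antisymm h (S.mapsTo ⟨le_rfl, zero_le_one⟩).1

/-- The concave function `psi 0` vanishes at `0`, with slope `1 / T'(0) < 1` there. -/
lemma psi_zero_lt (hS : S.IsAConvex) {z : ℝ} (hz : 0 < z) : S.psi 0 z < z := by
  obtain ⟨d, hd, hd'⟩ := hS.deriv_zero
  have h1 := hasDerivWithinAt_psi S.N_pos (d := d) (by linarith) (by rwa [S.a_zero])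
  rw [S.a_zero, T_zero hS] at h1
  have h2 := hasDerivWithinAt_dpsi_zero hS S.N_pos
  have h3 := (uniqueDiffWithinAt_Ici (0 : ℝ)).eq_deriv _ h2 h1
  have h4 := psiSum_sub_le hS (k := 1) S.N_pos le_rfl hz
  have h5 : S.psi 0 0 = 0 := by
    rw [psi_of_le S.N_pos (by rw [S.a_zero, T_zero hS]), S.a_zero]
  simp only [psiSum, dpsiSum, Finset.sum_range_one, h5, h3, sub_zero] at h4
  have : d⁻¹ < 1 := inv_lt_one_of_one_lt₀ hd
  nlinarith

lemma a_one_le (hS : S.IsAConvex) {x : ℝ} (hx : 0 < x) (h : S.T x ≤ x) : S.a 1 ≤ x := by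
  by_contra! hlt
  have hb : x ∈ S.branch 0 := ⟨by rw [S.a_zero]; exact hx.le, hlt⟩
  have h0 : S.T (S.a 0) < S.T x := S.strictMonoOn 0 S.N_pos (left_mem_branch S.N_pos) hb
    (by rwa [S.a_zero])
  rw [S.a_zero, T_zero hS] at h0
  have := psi_zero_lt hS h0
  rw [psi_T S.N_pos hb] at this
  linarith

/-- The image of the first branch reaches beyond `a 1`, by `psi_zero_lt` at its supremum. Hence the
cylinders `0…0` miss `β` and are subject to (B). -/
lemma a_one_lt_beta (hS : S.IsAConvex) : S.a 1 < S.beta := by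
  have h1 : S.a 1 < S.branchSup 0 := by
    have h2 := psi_zero_lt hS (z := S.branchSup 0) (by
      have := T_lt_branchSup S.N_pos (left_mem_branch S.N_pos)
      rwa [S.a_zero, T_zero hS] at this)
    rwa [psi_of_ge S.N_pos le_rfl] at h2
  obtain ⟨_, ⟨y, hy, rfl⟩, hlt⟩ := exists_lt_of_lt_csSup
    (⟨S.T (S.a 0), _, left_mem_branch S.N_pos, rfl⟩ : (S.T '' S.branch 0).Nonempty) h1
  refine hlt.trans_le (le_csSup ⟨1, ?_⟩ (mem_iUnion.2 ⟨1, y, ⟨?_, hy.2.le⟩, rfl⟩))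
  · rintro z hz
    obtain ⟨i, u, hu, rfl⟩ := mem_iUnion.1 hz
    exact (S.mapsTo.iterate i ⟨hu.1, hu.2.trans (a_le_one S.N_pos)⟩).2
  · have := hy.1
    rwa [S.a_zero] at this

lemma beta_le {x : ℝ} (hx1 : x ≤ 1) (ha : S.a 1 ≤ x)
    (h : ∀ y ∈ Icc 0 x, S.T y ≤ x) : S.beta ≤ x := by
  have hm : MapsTo S.T (Icc 0 x) (Icc 0 x) := fun y hy =>
    ⟨(S.mapsTo ⟨hy.1, hy.2.trans hx1⟩).1, h y hy⟩
  refine csSup_le ⟨0, mem_iUnion.2 ⟨0, 0, ⟨le_rfl, a_nonneg S.N_pos⟩, rfl⟩⟩ ?_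
  intro z hz
  obtain ⟨i, u, hu, rfl⟩ := mem_iUnion.1 hz
  exact (hm.iterate i ⟨hu.1, hu.2.trans ha⟩).2

/-- At `t = T (a k)` the derivative of `psi k` jumps from `0` to a positive value. Without a jump in
the sums, the chord estimates bound the slopes of `psi k` to the right of `t` by `dpsiSum k t -
dpsiSum k y → 0`, whereas these slopes tend to `1 / T'(a k) > 0`. -/
lemma a_T_mem_V (hS : S.IsAConvex) {k : ℕ} (hk : k < S.N) : S.T (S.a k) ∈ S.V := by
  have hm := T_mem_of_branch hk (left_mem_branch hk)
  rcases hm.1.eq_or_lt with h0 | h0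
  · rw [← h0]; exact Or.inr (Or.inl rfl)
  have h1 : S.T (S.a k) < 1 :=
    (T_lt_branchSup hk (left_mem_branch hk)).trans_le (branchSup_le_one hk)
  by_contra hV
  set t := S.T (S.a k) with ht
  have hc := continuousAt_dpsi hS hk ⟨h0, h1⟩ hV
  have hz : S.dpsi k t = 0 := by
    refine tendsto_nhds_unique (hc.tendsto.mono_left (nhdsWithin_le_nhds (s := Iio t))) ?_
    refine tendsto_const_nhds.congr' ?_
    filter_upwards [self_mem_nhdsWithin] with y hy using (dpsi_eq_zero_of_lt hk hy).symm
  obtain ⟨d, hd, hd'⟩ := hS.deriv_left k hk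
  have hder := hasDerivWithinAt_psi hk hd hd'
  rw [← hasDerivWithinAt_Ioi_iff_Ici, hasDerivWithinAt_iff_tendsto_slope' (by simp)] at hder
  have hlim : Tendsto (fun y => S.dpsiSum k t - S.dpsiSum k y) (𝓝[>] t) (𝓝 0) := by
    have := (tendsto_const_nhds (x := S.dpsiSum k t)).sub (continuousAt_dpsiSum hS hk.le
      ⟨h0, h1⟩ hV).tendsto
    rw [sub_self] at this
    exact this.mono_left nhdsWithin_le_nhds
  have hle : d⁻¹ ≤ 0 := by
    refine le_of_tendsto_of_tendsto hder hlim ?_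
    filter_upwards [self_mem_nhdsWithin] with y hy
    have hy : t < y := hy
    have h2 := psiSum_sub_le hS (Nat.succ_le_of_lt hk) h0.le hy
    have h3 := le_psiSum_sub hS hk.le h0.le hy
    rw [Nat.succ_eq_add_one, psiSum_succ, psiSum_succ, dpsiSum_succ, hz] at h2
    rw [slope_def_field, div_le_iff₀ (by linarith)]
    linarith
  exact absurd hle (not_le.2 (inv_pos.2 hd))

lemma mem_W_of_T_mem_V {x : ℝ} (hx : x ∈ Ioo 0 1) (h : S.T x ∈ S.V) : x ∈ S.W :=
  ⟨⟨⟨hx.1.le, hx.2.le⟩, mem_iUnion.2 ⟨1, mem_iUnion.2 ⟨0, _, h, rfl⟩⟩⟩, by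
    rintro (h | h)
    · exact hx.1.ne' h
    · exact hx.2.ne h⟩

lemma mem_W_of_mem_V {x : ℝ} (hx : x ∈ Ioo 0 1) (h : x ∈ S.V) : x ∈ S.W :=
  ⟨⟨⟨hx.1.le, hx.2.le⟩, mem_iUnion.2 ⟨0, mem_iUnion.2 ⟨0, _, h, rfl⟩⟩⟩, by
    rintro (h | h)
    · exact hx.1.ne' h
    · exact hx.2.ne h⟩

lemma W_subset : S.W ⊆ Ioo 0 1 := by
  rintro x ⟨⟨hx, _⟩, h⟩
  simp only [mem_insert_iff, mem_singleton_iff, not_or] at h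
  exact ⟨lt_of_le_of_ne hx.1 (Ne.symm h.1), lt_of_le_of_ne hx.2 h.2⟩

lemma mem_W_of_T_mem_W {x : ℝ} (hx : x ∈ Ioo 0 1) (h : S.T x ∈ S.W) : x ∈ S.W := by
  obtain ⟨⟨_, h⟩, _⟩ := h
  obtain ⟨i, hi⟩ := mem_iUnion.1 h
  refine ⟨⟨⟨hx.1.le, hx.2.le⟩, mem_iUnion.2 ⟨i + 1, ?_⟩⟩, ?_⟩
  · rwa [mem_preimage, Function.iterate_succ_apply]
  · rintro (h | h)
    · exact hx.1.ne' h
    · exact hx.2.ne h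

/-- The interior partition points are therefore duplicated, which makes the cylinders of length one
disjoint. -/
lemma a_mem_W (hS : S.IsAConvex) {k : ℕ} (hk0 : 0 < k) (hk : k < S.N) : S.a k ∈ S.W := by
  refine mem_W_of_T_mem_V ⟨?_, ?_⟩ (a_T_mem_V hS hk)
  · simpa [S.a_zero] using a_strict hk0 hk.le
  · simpa [S.a_last] using a_strict hk le_rfl

lemma V_countable (hS : S.IsAConvex) : S.V.Countable := by
  refine Countable.union ?_ (by simp)
  refine (Finset.countable_toSet _).biUnion fun k hk => ?_
  have hk' : k ≤ S.N := (Finset.mem_Icc.1 hk).2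
  refine ((dpsiSum_antitoneOn hS hk').comp_max_zero.countable_not_continuousAt).mono ?_
  rintro x ⟨hx, hne⟩ hc
  have hc' : ContinuousAt (S.dpsiSum k) x :=
    hc.congr (eventuallyEq_comp_max_zero _ hx.1).symm
  refine hne ?_
  change Function.rightLim (S.dpsiSum k) x = Function.leftLim (S.dpsiSum k) x
  rw [hc'.continuousWithinAt.rightLim_eq, hc'.continuousWithinAt.leftLim_eq]

/-- A preimage under `T` consists of images under the finitely many `psi k`, together with possibly
the point `1`, which is in no branch interval. -/
lemma countable_preimage_iterate {C : Set ℝ} (hC : C.Countable) (i : ℕ) :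
    (Icc 0 1 ∩ S.T^[i] ⁻¹' C).Countable := by
  induction i with
  | zero => exact hC.mono fun x hx => hx.2
  | succ i ih =>
    refine ((((Finset.range S.N).countable_toSet.biUnion
      fun k _ => ih.image (S.psi k))).union (countable_singleton 1)).mono ?_
    rintro x ⟨hx, hxC⟩
    rcases hx.2.eq_or_lt with h | h
    · exact Or.inr h
    · obtain ⟨k, hk, hxk⟩ := exists_branch hx.1 h
      refine Or.inl (mem_iUnion₂.2 ⟨k, by simpa using hk, S.T x, ⟨S.mapsTo hx, ?_⟩, psi_T hk hxk⟩)
      rwa [mem_preimage, Function.iterate_succ_apply] at hxC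

lemma W_countable (hS : S.IsAConvex) : S.W.Countable := by
  refine Countable.mono sdiff_subset ?_
  rw [inter_iUnion]
  exact countable_iUnion fun i => countable_preimage_iterate
    (countable_iUnion fun j => (V_countable hS).image _) i

end PiecewiseMap

/-! ### Order and topology of the split interval -/

namespace SplitInterval

variable {W : Set ℝ}

lemma lt_iff {p q : SplitInterval W} :
    p < q ↔ p.pt < q.pt ∨ (p.pt = q.pt ∧ p.tag < q.tag) := by
  change (toLex (p.pt, p.tag) : ℝ ×ₗ Bool) < toLex (q.pt, q.tag) ↔ _
  rw [Prod.Lex.toLex_lt_toLex]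

lemma le_iff {p q : SplitInterval W} :
    p ≤ q ↔ p.pt < q.pt ∨ (p.pt = q.pt ∧ p.tag ≤ q.tag) := by
  change (toLex (p.pt, p.tag) : ℝ ×ₗ Bool) ≤ toLex (q.pt, q.tag) ↔ _
  rw [Prod.Lex.toLex_le_toLex]

lemma lt_of_pt_lt {p q : SplitInterval W} (h : p.pt < q.pt) : p < q := lt_iff.2 (Or.inl h)

lemma pt_mono : Monotone (pt : SplitInterval W → ℝ) := fun p q h => by
  rcases le_iff.1 h with h | h
  · exact h.le
  · exact h.1.le

@[ext] lemma ext_iff' {p q : SplitInterval W} (h1 : p.pt = q.pt) (h2 : p.tag = q.tag) : p = q := by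
  cases p; cases q; simp_all

@[simp] lemma plus_tag (x : ℝ) : (plus W x).tag = true := rfl

lemma plus_pt {x : ℝ} (hx : x ∈ Icc (0 : ℝ) 1) : (plus W x).pt = x := by
  change ((projIcc (0 : ℝ) 1 zero_le_one x : Icc (0 : ℝ) 1) : ℝ) = x
  rw [projIcc_of_mem zero_le_one hx]

lemma minus_pt {x : ℝ} (hx : x ∈ Icc (0 : ℝ) 1) : (minus W x).pt = x := by
  unfold minus
  split_ifs
  · rfl
  · exact plus_pt hx

lemma minus_tag_of_mem {x : ℝ} (hx : x ∈ Icc (0 : ℝ) 1) (hW : x ∈ W) :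
    (minus W x).tag = false := by
  rw [minus, dif_pos ⟨hx, hW⟩]

lemma minus_of_notMem {x : ℝ} (hW : x ∉ W) : minus W x = plus W x := by
  rw [minus, dif_neg (fun h => hW h.2)]

lemma eq_plus {p : SplitInterval W} (h : p.tag = true) : p = plus W p.pt :=
  ext_iff' (plus_pt p.pt_mem).symm (by rw [h, plus_tag])

lemma eq_minus {p : SplitInterval W} (h : p.tag = false) : p = minus W p.pt :=
  ext_iff' (minus_pt p.pt_mem).symm (by rw [h, minus_tag_of_mem p.pt_mem (p.mem_of_tag h)])

lemma eq_plus_of_notMem {p : SplitInterval W} (h : p.pt ∉ W) : p = plus W p.pt := by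
  refine eq_plus ?_
  cases ht : p.tag
  · exact absurd (p.mem_of_tag ht) h
  · rfl

lemma minus_le_plus (x : ℝ) : minus W x ≤ plus W x := by
  by_cases h : x ∈ Icc (0 : ℝ) 1 ∧ x ∈ W
  · refine le_iff.2 (Or.inr ⟨?_, ?_⟩)
    · rw [minus_pt h.1, plus_pt h.1]
    · exact Bool.le_true _
  · rw [minus, dif_neg h]

lemma minus_lt_plus {x : ℝ} (hx : x ∈ Icc (0 : ℝ) 1) (hW : x ∈ W) : minus W x < plus W x := by
  refine lt_iff.2 (Or.inr ⟨?_, ?_⟩)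
  · rw [minus_pt hx, plus_pt hx]
  · rw [minus_tag_of_mem hx hW, plus_tag]; decide

lemma plus_mono : Monotone (plus W) := by
  intro x y h
  have h1 : (plus W x).pt ≤ (plus W y).pt := monotone_projIcc (zero_le_one : (0 : ℝ) ≤ 1) h
  rcases h1.lt_or_eq with h1 | h1
  · exact (lt_of_pt_lt h1).le
  · exact le_iff.2 (Or.inr ⟨h1, le_rfl⟩)

lemma le_plus {p : SplitInterval W} {x : ℝ} (hx : x ∈ Icc (0 : ℝ) 1) :
    p ≤ plus W x ↔ p.pt ≤ x := by
  simp only [le_iff, plus_pt hx, plus_tag, Bool.le_true, and_true]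
  exact le_iff_lt_or_eq.symm

lemma minus_le {p : SplitInterval W} {x : ℝ} (hx : x ∈ Icc (0 : ℝ) 1) :
    minus W x ≤ p ↔ x ≤ p.pt := by
  by_cases hW : x ∈ W
  · simp only [le_iff, minus_pt hx, minus_tag_of_mem hx hW, Bool.false_le, and_true]
    exact le_iff_lt_or_eq.symm
  · rw [minus_of_notMem hW]
    refine ⟨fun h => by simpa [plus_pt hx] using pt_mono h, fun h => ?_⟩
    rcases h.lt_or_eq with h | h
    · exact (lt_of_pt_lt (by rwa [plus_pt hx])).le
    · rw [h, ← eq_plus_of_notMem (by rwa [← h])]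

/-- Points with different projections are separated by a rational point. The remaining pairs `x⁻ <
x⁺` are countable in number, and rays at these points are added to the subbasis. -/
lemma secondCountableTopology (hW : W.Countable) : SecondCountableTopology (SplitInterval W) := by
  let D : Set (SplitInterval W) :=
    range (fun q : ℚ => plus W q) ∪ (plus W '' W ∪ minus W '' W)
  have hD : D.Countable := (countable_range _).union ((hW.image _).union (hW.image _))
  let B : Set (Set (SplitInterval W)) := Ioi '' D ∪ Iio '' D
  have hrat : ∀ p q : SplitInterval W, p.pt < q.pt → ∃ d ∈ D, p < d ∧ d < q := by
    intro p q h
    obtain ⟨r, h1, h2⟩ := exists_rat_btwn h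
    have hr : (r : ℝ) ∈ Icc (0 : ℝ) 1 := ⟨p.pt_mem.1.trans h1.le, h2.le.trans q.pt_mem.2⟩
    exact ⟨_, Or.inl ⟨r, rfl⟩, lt_of_pt_lt (by rwa [plus_pt hr]),
      lt_of_pt_lt (by rwa [plus_pt hr])⟩
  have hgap : ∀ p q : SplitInterval W, p < q → p.pt = q.pt → p ∈ D ∧ q ∈ D := by
    intro p q h he
    rcases lt_iff.1 h with h | ⟨_, h⟩
    · exact absurd he h.ne
    · obtain ⟨h1, h2⟩ := Bool.lt_iff.1 h
      have hp := p.mem_of_tag h1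
      exact ⟨Or.inr (Or.inr ⟨p.pt, hp, (eq_minus h1).symm⟩),
        Or.inr (Or.inl ⟨q.pt, he ▸ hp, (eq_plus h2).symm⟩)⟩
  refine ⟨B, (hD.image _).union (hD.image _), le_antisymm ?_ ?_⟩
  · refine le_generateFrom ?_
    rintro _ (⟨d, _, rfl⟩ | ⟨d, _, rfl⟩)
    · exact isOpen_Ioi
    · exact isOpen_Iio
  · rw [OrderTopology.topology_eq_generate_intervals (α := SplitInterval W)]
    refine le_generateFrom ?_
    rintro _ ⟨a, rfl | rfl⟩
    · have : Ioi a = ⋃ d ∈ {d ∈ D | a ≤ d}, Ioi d := by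
        ext p
        simp only [mem_Ioi, mem_iUnion, exists_prop]
        refine ⟨fun h => ?_, fun ⟨d, hd, h⟩ => hd.2.trans_lt h⟩
        rcases (pt_mono h.le).lt_or_eq with h' | h'
        · obtain ⟨d, hd, h1, h2⟩ := hrat a p h'
          exact ⟨d, ⟨hd, h1.le⟩, h2⟩
        · exact ⟨a, ⟨(hgap a p h h').1, le_rfl⟩, h⟩
      rw [this]
      exact @isOpen_biUnion _ _ (TopologicalSpace.generateFrom B) _ _ fun d hd =>
        TopologicalSpace.isOpen_generateFrom_of_mem (Or.inl ⟨d, hd.1, rfl⟩)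
    · have : Iio a = ⋃ d ∈ {d ∈ D | d ≤ a}, Iio d := by
        ext p
        simp only [mem_Iio, mem_iUnion, exists_prop]
        refine ⟨fun h => ?_, fun ⟨d, hd, h⟩ => h.trans_le hd.2⟩
        rcases (pt_mono h.le).lt_or_eq with h' | h'
        · obtain ⟨d, hd, h1, h2⟩ := hrat p a h'
          exact ⟨d, ⟨hd, h2.le⟩, h1⟩
        · exact ⟨a, ⟨(hgap p a h h').2, le_rfl⟩, h⟩
      rw [this]
      exact @isOpen_biUnion _ _ (TopologicalSpace.generateFrom B) _ _ fun d hd =>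
        TopologicalSpace.isOpen_generateFrom_of_mem (Or.inr ⟨d, hd.1, rfl⟩)

open Classical in
/-- The filter on `ℝ` along which a point of the split interval is approached. -/
def approach (p : SplitInterval W) : Filter ℝ :=
  if p.pt ∈ W then (if p.tag then 𝓝[>] p.pt else 𝓝[<] p.pt) else pure p.pt

instance (p : SplitInterval W) : (approach p).NeBot := by
  unfold approach
  split_ifs <;> infer_instance

lemma approach_le (p : SplitInterval W) : approach p ≤ 𝓝 p.pt := by
  unfold approach
  split_ifs
  · exact nhdsWithin_le_nhds
  · exact nhdsWithin_le_nhds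
  · exact pure_le_nhds _

lemma eventually_approach_mem_Icc (hW : W ⊆ Ioo 0 1) (p : SplitInterval W) :
    ∀ᶠ u in approach p, u ∈ Icc (0 : ℝ) 1 := by
  by_cases h : p.pt ∈ W
  · exact approach_le p (Icc_mem_nhds (hW h).1 (hW h).2)
  · rw [approach, if_neg h]
    exact p.pt_mem

/-- One-sided limits of a non-increasing function are non-increasing on the split interval. -/
lemma antitone_of_tendsto_approach (hW : W ⊆ Ioo 0 1) {f : ℝ → ℝ} (hf : AntitoneOn f (Icc 0 1))
    {G : SplitInterval W → ℝ} (hG : ∀ p, Tendsto f (approach p) (𝓝 (G p))) : Antitone G := by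
  intro p q hpq
  have key : ∃ z ∈ Icc (0 : ℝ) 1,
      (∀ᶠ u in approach p, u ≤ z) ∧ (∀ᶠ u in approach q, z ≤ u) ∨ p = q := by
    rcases le_iff.1 hpq with h | ⟨h, ht⟩
    · obtain ⟨z, h1, h2⟩ := exists_between h
      refine ⟨z, ⟨p.pt_mem.1.trans h1.le, h2.le.trans q.pt_mem.2⟩, Or.inl ⟨?_, ?_⟩⟩
      · exact approach_le p (Iic_mem_nhds h1)
      · exact approach_le q (Ici_mem_nhds h2)
    · refine ⟨p.pt, p.pt_mem, ?_⟩
      rcases ht.lt_or_eq with ht | ht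
      · obtain ⟨h1, h2⟩ := Bool.lt_iff.1 ht
        have hp := p.mem_of_tag h1
        refine Or.inl ⟨?_, ?_⟩
        · rw [approach, if_pos hp, h1, if_neg (by simp)]
          filter_upwards [self_mem_nhdsWithin] with u hu using le_of_lt hu
        · rw [approach, if_pos (h ▸ hp), h2, if_pos rfl, ← h]
          filter_upwards [self_mem_nhdsWithin] with u hu using le_of_lt hu
      · exact Or.inr (ext_iff' h ht)
  obtain ⟨z, hz, ⟨h1, h2⟩ | h⟩ := key
  · refine (le_of_tendsto (b := f z) (hG q) ?_).trans (ge_of_tendsto (hG p) ?_)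
    · filter_upwards [h2, eventually_approach_mem_Icc hW q] with u hu hu' using hf hz hu' hu
    · filter_upwards [h1, eventually_approach_mem_Icc hW p] with u hu hu' using hf hu' hz hu
  · rw [h]

end SplitInterval

/-! ### The extended map and inverse branches on the split interval -/

namespace PiecewiseMap

open SplitInterval

variable {S : PiecewiseMap}

lemma a_mem_Icc {k : ℕ} (hk : k ≤ S.N) : S.a k ∈ Icc (0 : ℝ) 1 := ⟨a_nonneg hk, a_le_one hk⟩

lemma psi_mem_Icc {k : ℕ} (hk : k < S.N) (x : ℝ) : S.psi k x ∈ Icc (0 : ℝ) 1 :=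
  ⟨(a_nonneg hk.le).trans (psi_mem hk x).1, (psi_mem hk x).2.trans (a_le_one hk)⟩

lemma tendsto_dpsiX (hS : S.IsAConvex) {k : ℕ} (hk : k < S.N) (p : S.X) :
    Tendsto (S.dpsi k) (approach p) (𝓝 (S.dpsiX k p)) := by
  unfold approach dpsiX
  split_ifs with h1 h2
  · exact tendsto_rightLim_dpsi hS hk (W_subset h1).1
  · exact tendsto_leftLim_dpsi hS hk (W_subset h1).1
  · exact tendsto_pure_nhds _ _

lemma dpsiX_nonneg (hS : S.IsAConvex) {k : ℕ} (hk : k < S.N) (p : S.X) : 0 ≤ S.dpsiX k p :=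
  ge_of_tendsto' (tendsto_dpsiX hS hk p) fun x => dpsi_nonneg hk x

lemma dpsiX_eq_zero (hS : S.IsAConvex) {k : ℕ} (hk : k < S.N) {p : S.X}
    (h : ∀ᶠ u in approach p, S.dpsi k u = 0) : S.dpsiX k p = 0 :=
  tendsto_nhds_unique ((tendsto_dpsiX hS hk p).congr' h) tendsto_const_nhds

lemma sum_dpsiX_antitone (hS : S.IsAConvex) {k : ℕ} (hk : k ≤ S.N) :
    Antitone fun p : S.X => ∑ i ∈ Finset.range k, S.dpsiX i p :=
  antitone_of_tendsto_approach W_subset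
    ((dpsiSum_antitoneOn hS hk).mono Icc_subset_Ici_self) fun p =>
    tendsto_finsetSum _ fun _ hi => tendsto_dpsiX hS ((Finset.mem_range.1 hi).trans_le hk) p

lemma measurable_dpsiX (hS : S.IsAConvex) {k : ℕ} (hk : k < S.N) : Measurable (S.dpsiX k) := by
  have h : S.dpsiX k = fun p => (∑ i ∈ Finset.range (k + 1), S.dpsiX i p) -
      ∑ i ∈ Finset.range k, S.dpsiX i p := by
    ext p; rw [Finset.sum_range_succ]; ring
  rw [h]
  exact (sum_dpsiX_antitone hS hk).measurable.sub (sum_dpsiX_antitone hS hk.le).measurable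

lemma sum_dpsiX_rpow_antitone (hS : S.IsAConvex) {s : ℝ} (hs : 0 < s) (hC : S.CondC s) {k : ℕ}
    (hk : k ≤ S.N) : Antitone fun p : S.X => ∑ i ∈ Finset.range k, S.dpsiX i p ^ s := by
  rcases Nat.eq_zero_or_pos k with rfl | hk0
  · simp only [Finset.range_zero, Finset.sum_empty]; exact antitone_const
  · exact antitone_of_tendsto_approach W_subset (hC k hk0 hk).2 fun p =>
      tendsto_finsetSum _ fun _ hi =>
        (tendsto_dpsiX hS ((Finset.mem_range.1 hi).trans_le hk) p).rpow_const (Or.inr hs.le)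

open Classical in
lemma psiX_cases {k : ℕ} (hk : k < S.N) (p : S.X) :
    (p.pt ≤ S.T (S.a k) ∧ S.psiX k p = plus S.W (S.a k)) ∨
    (S.branchSup k ≤ p.pt ∧ S.psiX k p = minus S.W (S.a (k + 1))) ∨
    (S.psi k p.pt ∈ Ioo (S.a k) (S.a (k + 1)) ∧ S.T (S.psi k p.pt) = p.pt ∧
      S.psiX k p = if p.tag then plus S.W (S.psi k p.pt) else minus S.W (S.psi k p.pt)) := by
  have hlt := T_lt_branchSup hk (left_mem_branch hk)
  unfold psiX
  rw [sInf_image_branch hk]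
  change _ ∨ _ ∧ (if _ then _ else if S.branchSup k ≤ p.pt then _ else _) = _ ∨ _ ∧ _ ∧
    (if _ then _ else if S.branchSup k ≤ p.pt then _ else _) = _
  rcases psi_cases hk p.pt with ⟨h, _⟩ | ⟨h, _⟩ | ⟨h1, h2, h3, h4⟩
  · exact Or.inl ⟨h, if_pos h⟩
  · exact Or.inr (Or.inl ⟨h, by rw [if_neg (by linarith), if_pos h]⟩)
  · exact Or.inr (Or.inr ⟨h3, h4, by rw [if_neg (by linarith), if_neg (by linarith)]⟩)

lemma plus_a_lt_minus_a {k : ℕ} (hk : k < S.N) :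
    plus S.W (S.a k) < minus S.W (S.a (k + 1)) :=
  lt_of_pt_lt (by rw [plus_pt (a_mem_Icc hk.le), minus_pt (a_mem_Icc hk)]; exact S.a_lt k hk)

lemma psiX_pt {k : ℕ} (hk : k < S.N) (p : S.X) : (S.psiX k p).pt = S.psi k p.pt := by
  rcases psiX_cases hk p with ⟨h, h'⟩ | ⟨h, h'⟩ | ⟨h, _, h'⟩
  · rw [h', plus_pt (a_mem_Icc hk.le), psi_of_le hk h]
  · rw [h', minus_pt (a_mem_Icc hk), psi_of_ge hk h]
  · rw [h']
    split_ifs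
    · exact plus_pt (psi_mem_Icc hk _)
    · exact minus_pt (psi_mem_Icc hk _)

lemma psiX_mem {k : ℕ} (hk : k < S.N) (p : S.X) :
    S.psiX k p ∈ Icc (plus S.W (S.a k)) (minus S.W (S.a (k + 1))) := by
  rcases psiX_cases hk p with ⟨h, h'⟩ | ⟨h, h'⟩ | ⟨h, _, _⟩
  · rw [h']; exact ⟨le_rfl, (plus_a_lt_minus_a hk).le⟩
  · rw [h']; exact ⟨(plus_a_lt_minus_a hk).le, le_rfl⟩
  · rw [← psiX_pt hk] at h
    exact ⟨(lt_of_pt_lt (by rw [plus_pt (a_mem_Icc hk.le)]; exact h.1)).le,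
      (lt_of_pt_lt (by rw [minus_pt (a_mem_Icc hk)]; exact h.2)).le⟩

lemma psiX_mono {k : ℕ} (hk : k < S.N) : Monotone (S.psiX k) := by
  intro p q hpq
  have hpt := pt_mono hpq
  rcases psiX_cases hk p with ⟨_, h⟩ | ⟨h', h⟩ | ⟨h1, h2, h3⟩
  · rw [h]; exact (psiX_mem hk q).1
  · rcases psiX_cases hk q with ⟨h1, _⟩ | ⟨_, h2⟩ | ⟨h1, _, _⟩
    · have := T_lt_branchSup hk (left_mem_branch hk)
      linarith
    · rw [h, h2]
    · rw [psi_of_ge hk (h'.trans hpt)] at h1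
      exact absurd h1.2 (lt_irrefl _)
  · rcases psiX_cases hk q with ⟨h1', _⟩ | ⟨_, h2'⟩ | ⟨h1', h2', h3'⟩
    · rw [psi_of_le hk (hpt.trans h1')] at h1
      exact absurd h1.1 (lt_irrefl _)
    · rw [h2']; exact (psiX_mem hk p).2
    · rcases le_iff.1 hpq with h | ⟨h, ht⟩
      · refine (lt_of_pt_lt ?_).le
        rw [psiX_pt hk, psiX_pt hk]
        refine lt_of_le_of_ne (psi_mono hk hpt) fun he => ?_
        rw [he, h2'] at h2
        exact h.ne' h2
      · rw [h3, h3', h]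
        rcases ht.lt_or_eq with ht | ht
        · obtain ⟨ha, hb⟩ := Bool.lt_iff.1 ht
          rw [ha, hb]
          simpa using minus_le_plus _
        · rw [ht]

lemma psiX_le_psiX_succ {k : ℕ} (hk : k + 1 < S.N) (p : S.X) : S.psiX k p ≤ S.psiX (k + 1) p :=
  (psiX_mem (by omega) p).2.trans ((minus_le_plus _).trans (psiX_mem hk p).1)

lemma tendsto_T_branchSup {k : ℕ} (hk : k < S.N) :
    Tendsto S.T (𝓝[<] S.a (k + 1)) (𝓝 (S.branchSup k)) := by
  refine tendsto_order.2 ⟨fun b hb => ?_, fun b hb => ?_⟩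
  · obtain ⟨_, ⟨y, hy, rfl⟩, hlt⟩ := exists_lt_of_lt_csSup
      (⟨S.T (S.a k), _, left_mem_branch hk, rfl⟩ : (S.T '' S.branch k).Nonempty) hb
    filter_upwards [Ioo_mem_nhdsLT hy.2] with u hu
    exact hlt.trans (S.strictMonoOn k hk hy ⟨hy.1.trans hu.1.le, hu.2⟩ hu.1)
  · filter_upwards [Ioo_mem_nhdsLT (S.a_lt k hk)] with u hu
    exact (T_lt_branchSup hk ⟨hu.1.le, hu.2⟩).trans hb

lemma continuousAt_T {k : ℕ} (hk : k < S.N) {x : ℝ} (hx : x ∈ Ioo (S.a k) (S.a (k + 1))) :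
    ContinuousAt S.T x :=
  (S.continuousOn k hk x ⟨hx.1.le, hx.2⟩).continuousAt (Ico_mem_nhds hx.1 hx.2)

lemma notMem_W_one : (1 : ℝ) ∉ S.W := fun h => absurd (W_subset h).2 (lt_irrefl _)

lemma notMem_W_zero : (0 : ℝ) ∉ S.W := fun h => absurd (W_subset h).1 (lt_irrefl _)

lemma TX_minus_a (hS : S.IsAConvex) {k : ℕ} (hk : k < S.N) :
    S.TX (minus S.W (S.a (k + 1))) = minus S.W (S.branchSup k) := by
  have h : (minus S.W (S.a (k + 1))).tag = false ∨ (minus S.W (S.a (k + 1))).pt = 1 := by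
    rcases (show k + 1 ≤ S.N from hk).lt_or_eq with h | h
    · exact Or.inl (minus_tag_of_mem (a_mem_Icc hk) (a_mem_W hS (Nat.succ_pos k) h))
    · right; rw [minus_pt (a_mem_Icc hk), show k.succ = S.N from h, S.a_last]
  rw [TX, if_pos h, minus_pt (a_mem_Icc hk), leftLim_eq_of_tendsto (tendsto_T_branchSup hk)]

lemma TX_of_tag_true {k : ℕ} (hk : k < S.N) {p : S.X} (hp : p.pt ∈ S.branch k)
    (ht : p.tag = true) : S.TX p = plus S.W (S.T p.pt) := by
  rw [TX, if_neg]
  rw [ht]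
  simp only [Bool.true_eq_false, false_or]
  exact (hp.2.trans_le (a_le_one hk)).ne

lemma TX_of_tag_false {k : ℕ} (hk : k < S.N) {p : S.X} (hp : p.pt ∈ Ioo (S.a k) (S.a (k + 1)))
    (ht : p.tag = false) : S.TX p = minus S.W (S.T p.pt) := by
  rw [TX, if_pos (Or.inl ht), (continuousAt_T hk hp).continuousWithinAt.leftLim_eq]

/-- Where `psi k` is constant along the approach to `p`, the weight vanishes. This excludes the
points outside the image of the cylinder, including those on the wrong side of a duplicated end
point. -/
lemma TX_psiX (hS : S.IsAConvex) {k : ℕ} (hk : k < S.N) {p : S.X} (hd : S.dpsiX k p ≠ 0) :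
    S.TX (S.psiX k p) = p := by
  rcases psiX_cases hk p with ⟨h, h'⟩ | ⟨h, h'⟩ | ⟨h1, h2, h3⟩
  · have hpt : p.pt = S.T (S.a k) := by
      by_contra hne
      refine hd (dpsiX_eq_zero hS hk ?_)
      filter_upwards [approach_le p (Iio_mem_nhds (lt_of_le_of_ne h hne))] with u hu
      exact dpsi_eq_zero_of_lt hk hu
    have ht : p.tag = true := by
      by_contra ht
      rw [Bool.not_eq_true] at ht
      refine hd (dpsiX_eq_zero hS hk ?_)
      rw [approach, if_pos (p.mem_of_tag ht), ht, if_neg (by simp)]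
      filter_upwards [self_mem_nhdsWithin] with u hu
      exact dpsi_eq_zero_of_lt hk (hpt ▸ hu)
    have hm : (plus S.W (S.a k)).pt ∈ S.branch k := by
      rw [plus_pt (a_mem_Icc hk.le)]; exact left_mem_branch hk
    rw [h', TX_of_tag_true hk hm rfl, plus_pt (a_mem_Icc hk.le), ← hpt, ← eq_plus ht]
  · have hpt : S.branchSup k = p.pt := by
      by_contra hne
      refine hd (dpsiX_eq_zero hS hk ?_)
      filter_upwards [approach_le p (Ioi_mem_nhds (lt_of_le_of_ne h hne))] with u hu
      exact dpsi_eq_zero_of_gt hk hu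
    rw [h', TX_minus_a hS hk, hpt]
    cases ht : p.tag
    · exact (eq_minus ht).symm
    · by_cases hW : p.pt ∈ S.W
      · exfalso
        refine hd (dpsiX_eq_zero hS hk ?_)
        rw [approach, if_pos hW, ht, if_pos rfl]
        filter_upwards [self_mem_nhdsWithin] with u hu
        exact dpsi_eq_zero_of_gt hk (hpt ▸ hu)
      · rw [minus_of_notMem hW, ← eq_plus_of_notMem hW]
  · have hI := psi_mem_Icc hk p.pt
    cases ht : p.tag
    · rw [ht, if_neg (by simp)] at h3
      -- Backward invariance of `W` ensures that the preimage of a point `x⁻` is itself duplicated.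
      have hW : S.psi k p.pt ∈ S.W := by
        refine mem_W_of_T_mem_W ⟨(a_nonneg hk.le).trans_lt h1.1, h1.2.trans_le (a_le_one hk)⟩ ?_
        rw [h2]; exact p.mem_of_tag ht
      rw [h3, TX_of_tag_false hk (by rwa [minus_pt hI]) (minus_tag_of_mem hI hW), minus_pt hI, h2,
        ← eq_minus ht]
    · rw [ht, if_pos rfl] at h3
      rw [h3, TX_of_tag_true hk (by rw [plus_pt hI]; exact ⟨h1.1.le, h1.2⟩) rfl, plus_pt hI, h2,
        ← eq_plus ht]

lemma exists_mem_cylinder (p : S.X) :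
    ∃ k < S.N, p ∈ Icc (plus S.W (S.a k)) (minus S.W (S.a (k + 1))) := by
  have hend : ∀ k < S.N, p = minus S.W (S.a (k + 1)) →
      p ∈ Icc (plus S.W (S.a k)) (minus S.W (S.a (k + 1))) := by
    rintro k hk rfl
    exact ⟨(plus_a_lt_minus_a hk).le, le_rfl⟩
  rcases p.pt_mem.2.eq_or_lt with h | h
  · have hN : S.N - 1 + 1 = S.N := Nat.sub_add_cancel S.N_pos
    refine ⟨S.N - 1, by omega, hend _ (by omega) ?_⟩
    rw [hN, S.a_last, minus_of_notMem notMem_W_one, ← h]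
    exact eq_plus_of_notMem (h ▸ notMem_W_one)
  · obtain ⟨k, hk, hb⟩ := exists_branch p.pt_mem.1 h
    -- The point `(a k)⁻` projects into branch `k` but belongs to the preceding cylinder.
    by_cases hc : p.pt = S.a k ∧ p.tag = false
    · have hk0 : k ≠ 0 := by
        rintro rfl
        have := p.mem_of_tag hc.2
        rw [hc.1, S.a_zero] at this
        exact notMem_W_zero this
      obtain ⟨j, rfl⟩ := Nat.exists_eq_succ_of_ne_zero hk0
      have hj : j < S.N := (Nat.lt_succ_self j).trans hk
      have := eq_minus hc.2
      rw [hc.1] at this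
      exact ⟨j, hj, hend j hj this⟩
    · refine ⟨k, hk, le_iff.2 ?_, (lt_of_pt_lt ?_).le⟩
      · rw [plus_pt (a_mem_Icc hk.le)]
        rcases hb.1.lt_or_eq with h' | h'
        · exact Or.inl h'
        · refine Or.inr ⟨h', ?_⟩
          cases ht : p.tag
          · exact absurd ⟨h'.symm, ht⟩ hc
          · exact le_rfl
      · rw [minus_pt (a_mem_Icc hk)]; exact hb.2

/-- The three kinds of points of a cylinder of length one, with their images. -/
lemma TX_cases (hS : S.IsAConvex) {k : ℕ} (hk : k < S.N) {p : S.X}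
    (hp : p ∈ Icc (plus S.W (S.a k)) (minus S.W (S.a (k + 1)))) :
    (p = minus S.W (S.a (k + 1)) ∧ S.TX p = minus S.W (S.branchSup k)) ∨
    (p.tag = true ∧ p.pt ∈ S.branch k ∧ S.TX p = plus S.W (S.T p.pt)) ∨
    (p.tag = false ∧ p.pt ∈ S.branch k ∧ S.TX p = minus S.W (S.T p.pt)) := by
  have h1 := pt_mono hp.1
  have h2 := pt_mono hp.2
  rw [plus_pt (a_mem_Icc hk.le)] at h1
  rw [minus_pt (a_mem_Icc hk)] at h2
  rcases h2.lt_or_eq with h2 | h2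
  · cases ht : p.tag
    · refine Or.inr (Or.inr ⟨rfl, ⟨h1, h2⟩, TX_of_tag_false hk ⟨lt_of_le_of_ne h1 ?_, h2⟩ ht⟩)
      intro he
      rcases le_iff.1 hp.1 with h | ⟨_, h⟩
      · rw [plus_pt (a_mem_Icc hk.le)] at h
        exact h.ne he
      · rw [ht, plus_tag] at h
        exact absurd h (by decide)
    · exact Or.inr (Or.inl ⟨rfl, ⟨h1, h2⟩, TX_of_tag_true hk ⟨h1, h2⟩ ht⟩)
  · have : p = minus S.W (S.a (k + 1)) := le_antisymm hp.2 ((minus_le (a_mem_Icc hk)).2 h2.ge)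
    exact Or.inl ⟨this, this ▸ TX_minus_a hS hk⟩

lemma TX_monotoneOn (hS : S.IsAConvex) {k : ℕ} (hk : k < S.N) :
    MonotoneOn S.TX (Icc (plus S.W (S.a k)) (minus S.W (S.a (k + 1)))) := by
  have hpl : ∀ {x y : ℝ}, x ∈ Icc (0 : ℝ) 1 → y ∈ Icc (0 : ℝ) 1 → x < y →
      plus S.W x ≤ minus S.W y := fun hx hy h =>
    (lt_of_pt_lt (by rwa [plus_pt hx, minus_pt hy])).le
  have hsup : S.branchSup k ∈ Icc (0 : ℝ) 1 :=
    ⟨(T_mem_of_branch hk (left_mem_branch hk)).1.trans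
      (T_lt_branchSup hk (left_mem_branch hk)).le, branchSup_le_one hk⟩
  intro p hp q hq hpq
  have hpt := pt_mono hpq
  have hstrict : ∀ {x y}, x ∈ S.branch k → y ∈ S.branch k → x < y →
      plus S.W (S.T x) ≤ minus S.W (S.T y) := fun hx hy h =>
    hpl (T_mem_of_branch hk hx) (T_mem_of_branch hk hy) (S.strictMonoOn k hk hx hy h)
  rcases TX_cases hS hk hq with ⟨hq1, hq2⟩ | ⟨hq1, hq2, hq3⟩ | ⟨hq1, hq2, hq3⟩
  · rcases TX_cases hS hk hp with ⟨hp1, hp2⟩ | ⟨hp1, hp2, hp3⟩ | ⟨hp1, hp2, hp3⟩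
    · rw [hp2, hq2]
    · rw [hp3, hq2]
      exact hpl (T_mem_of_branch hk hp2) hsup (T_lt_branchSup hk hp2)
    · rw [hp3, hq2]
      exact (minus_le_plus _).trans (hpl (T_mem_of_branch hk hp2) hsup (T_lt_branchSup hk hp2))
  all_goals
    rcases TX_cases hS hk hp with ⟨hp1, hp2⟩ | ⟨hp1, hp2, hp3⟩ | ⟨hp1, hp2, hp3⟩
    · rw [hp1, minus_pt (a_mem_Icc hk)] at hpt
      exact absurd hq2.2 (not_lt.2 hpt)
    all_goals
      rw [hp3, hq3]
      rcases le_iff.1 hpq with h | ⟨h, ht⟩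
      · first
          | exact hstrict hp2 hq2 h
          | exact (hstrict hp2 hq2 h).trans (minus_le_plus _)
          | exact (minus_le_plus _).trans (hstrict hp2 hq2 h)
          | exact (minus_le_plus _).trans ((hstrict hp2 hq2 h).trans (minus_le_plus _))
      · first
          | (rw [h]; done)
          | (rw [h]; exact minus_le_plus _)
          | (rw [hp1, hq1] at ht; exact absurd ht (by decide))

/-- On each of the finitely many cylinders `TX` is monotone, so the preimage of a ray meets it in an
order-convex set. -/
lemma measurable_TX (hS : S.IsAConvex) : Measurable S.TX := by
  have := secondCountableTopology (W_countable hS)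
  refine measurable_of_Iic fun q => ?_
  have : S.TX ⁻¹' Iic q = ⋃ k ∈ Finset.range S.N,
      (Icc (plus S.W (S.a k)) (minus S.W (S.a (k + 1))) ∩ S.TX ⁻¹' Iic q) := by
    ext p
    simp only [mem_iUnion, mem_inter_iff, exists_prop, Finset.mem_range]
    refine ⟨fun h => ?_, fun ⟨_, _, _, h⟩ => h⟩
    obtain ⟨k, hk, hp⟩ := exists_mem_cylinder p
    exact ⟨k, hk, hp, h⟩
  rw [this]
  refine Finset.measurableSet_biUnion _ fun k hk => ?_
  have hoc : OrdConnected (Icc (plus S.W (S.a k)) (minus S.W (S.a (k + 1))) ∩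
      S.TX ⁻¹' Iic q) := by
    refine ⟨fun x hx y hy z hz => ⟨⟨hx.1.1.trans hz.1, hz.2.trans hy.1.2⟩, ?_⟩⟩
    exact (TX_monotoneOn hS (Finset.mem_range.1 hk) ⟨hx.1.1.trans hz.1, hz.2.trans hy.1.2⟩ hy.1
      hz.2).trans hy.2
  exact hoc.measurableSet

end PiecewiseMap

/-! ### Abel summation and the transfer operator -/

/-- Abel summation against a non-negative, non-increasing sequence. -/
lemma sum_mul_le_sum_mul_of_partial_sums_le {N : ℕ} {u v c : ℕ → ℝ}
    (huv : ∀ k ≤ N, ∑ i ∈ Finset.range k, u i ≤ ∑ i ∈ Finset.range k, v i)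
    (hc : ∀ k < N, 0 ≤ c k) (hanti : ∀ k, k + 1 < N → c (k + 1) ≤ c k) :
    ∑ i ∈ Finset.range N, u i * c i ≤ ∑ i ∈ Finset.range N, v i * c i := by
  -- The boundary term of the summation by parts is kept, so that the induction closes using only `c
  -- (n + 1) ≤ c n`.
  have key : ∀ n, n < N → (∑ i ∈ Finset.range (n + 1), v i - ∑ i ∈ Finset.range (n + 1), u i) * c n
      ≤ ∑ i ∈ Finset.range (n + 1), v i * c i - ∑ i ∈ Finset.range (n + 1), u i * c i := by
    intro n
    induction n with
    | zero => intro _; simp only [zero_add, Finset.sum_range_one]; linarith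
    | succ n ih =>
      intro hn
      have h1 := ih (by omega)
      have h2 := huv (n + 1) (by omega)
      have h3 := hanti n hn
      rw [Finset.sum_range_succ _ (n + 1), Finset.sum_range_succ _ (n + 1),
        Finset.sum_range_succ _ (n + 1), Finset.sum_range_succ _ (n + 1)]
      nlinarith [mul_le_mul_of_nonneg_left h3 (sub_nonneg.2 h2)]
  rcases Nat.eq_zero_or_pos N with rfl | hN
  · simp
  · have h := key (N - 1) (by omega)
    rw [Nat.sub_add_cancel hN] at h
    have h1 := mul_nonneg (sub_nonneg.2 (huv N le_rfl)) (hc (N - 1) (by omega))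
    linarith

namespace PiecewiseMap

open SplitInterval

variable {S : PiecewiseMap} {s : ℝ}

lemma weight_nonneg (hS : S.IsAConvex) {k : ℕ} (hk : k < S.N) (p : S.X) :
    0 ≤ S.dpsiX k p ^ s := Real.rpow_nonneg (dpsiX_nonneg hS hk p) s

lemma dpsiX_ne_zero_of_weight (hs : 0 < s) {k : ℕ} {p : S.X} (h : S.dpsiX k p ^ s ≠ 0) :
    S.dpsiX k p ≠ 0 := by
  intro h0
  rw [h0, Real.zero_rpow hs.ne'] at h
  exact h rfl

lemma plus_zero_le (p : S.X) : plus S.W 0 ≤ p := by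
  rw [← minus_of_notMem notMem_W_zero, minus_le ⟨le_rfl, zero_le_one⟩]
  exact p.pt_mem.1

lemma F_nonneg (hS : S.IsAConvex) {f : S.X → ℝ} (hf : ∀ p, 0 ≤ f p) (p : S.X) : 0 ≤ S.F s f p :=
  Finset.sum_nonneg fun _ hk => mul_nonneg (weight_nonneg hS (Finset.mem_range.1 hk) p) (hf _)

/-- Moving the arguments of `f` from `q` back to `p` increases each term, as `psiX k` is monotone.
With the arguments fixed, `f (psiX k p)` decreases in `k`, and (C) compares the partial sums of the
weights. -/
lemma F_antitone (hS : S.IsAConvex) (hs : 0 < s) (hC : S.CondC s) {f : S.X → ℝ}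
    (hf : ∀ p, 0 ≤ f p) (ha : Antitone f) : Antitone (S.F s f) := by
  intro p q hpq
  calc S.F s f q ≤ ∑ k ∈ Finset.range S.N, S.dpsiX k q ^ s * f (S.psiX k p) :=
        Finset.sum_le_sum fun k hk => mul_le_mul_of_nonneg_left
          (ha (psiX_mono (Finset.mem_range.1 hk) hpq)) (weight_nonneg hS (Finset.mem_range.1 hk) q)
    _ ≤ S.F s f p := sum_mul_le_sum_mul_of_partial_sums_le
        (fun k hk => sum_dpsiX_rpow_antitone hS hs hC hk hpq) (fun _ _ => hf _)
        (fun k hk => ha (psiX_le_psiX_succ hk p))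

lemma F_le (hS : S.IsAConvex) (hs : 0 < s) (hC : S.CondC s) {f : S.X → ℝ} {K : ℝ} (hK : 0 ≤ K)
    (hf : ∀ p, f p ≤ K) (p : S.X) :
    S.F s f p ≤ (∑ k ∈ Finset.range S.N, S.dpsiX k (plus S.W 0) ^ s) * K := by
  calc S.F s f p ≤ (∑ k ∈ Finset.range S.N, S.dpsiX k p ^ s) * K := by
        rw [Finset.sum_mul]
        exact Finset.sum_le_sum fun k hk =>
          mul_le_mul_of_nonneg_left (hf _) (weight_nonneg hS (Finset.mem_range.1 hk) p)
    _ ≤ _ := mul_le_mul_of_nonneg_right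
        (sum_dpsiX_rpow_antitone hS hs hC le_rfl (plus_zero_le p)) hK

variable (S) in
/-- The transfer operator on functions with values in `[0, ∞]`. -/
def Fe (s : ℝ) (f : S.X → ENNReal) (p : S.X) : ENNReal :=
  ∑ k ∈ Finset.range S.N, ENNReal.ofReal (S.dpsiX k p ^ s) * f (S.psiX k p)

lemma ofReal_F (hS : S.IsAConvex) {f : S.X → ℝ} (hf : ∀ p, 0 ≤ f p) (p : S.X) :
    ENNReal.ofReal (S.F s f p) = S.Fe s (fun q => ENNReal.ofReal (f q)) p := by
  rw [F, ENNReal.ofReal_sum_of_nonneg fun k hk =>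
    mul_nonneg (weight_nonneg hS (Finset.mem_range.1 hk) p) (hf _)]
  exact Finset.sum_congr rfl fun k hk =>
    ENNReal.ofReal_mul (weight_nonneg hS (Finset.mem_range.1 hk) p)

lemma measurable_weight (hS : S.IsAConvex) {k : ℕ} (hk : k < S.N) :
    Measurable fun p => ENNReal.ofReal (S.dpsiX k p ^ s) :=
  ((measurable_dpsiX hS hk).pow_const s).ennreal_ofReal

lemma measurable_psiX (hS : S.IsAConvex) {k : ℕ} (hk : k < S.N) : Measurable (S.psiX k) := by
  have := secondCountableTopology (W_countable hS)
  exact (psiX_mono hk).measurable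

lemma measurable_Fe (hS : S.IsAConvex) {f : S.X → ENNReal} (hf : Measurable f) :
    Measurable (S.Fe s f) :=
  Finset.measurable_sum _ fun _ hk => (measurable_weight hS (Finset.mem_range.1 hk)).mul
    (hf.comp (measurable_psiX hS (Finset.mem_range.1 hk)))

lemma measurable_F (hS : S.IsAConvex) {f : S.X → ℝ} (hf : Measurable f) :
    Measurable (S.F s f) :=
  Finset.measurable_sum _ fun _ hk => ((measurable_dpsiX hS (Finset.mem_range.1 hk)).pow_const s).mul
    (hf.comp (measurable_psiX hS (Finset.mem_range.1 hk)))

variable (S) in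
/-- The image of `m` under the dual transfer operator. -/
def dualF (s : ℝ) (m : Measure S.X) : Measure S.X :=
  ∑ k ∈ Finset.range S.N,
    (m.withDensity fun p => ENNReal.ofReal (S.dpsiX k p ^ s)).map (S.psiX k)

lemma lintegral_dualF (hS : S.IsAConvex) (m : Measure S.X) {f : S.X → ENNReal}
    (hf : Measurable f) : ∫⁻ p, f p ∂(S.dualF s m) = ∫⁻ p, S.Fe s f p ∂m := by
  rw [dualF, lintegral_finsetSum_measure]
  have hmeas : ∀ k ∈ Finset.range S.N,
      Measurable fun p => ENNReal.ofReal (S.dpsiX k p ^ s) * f (S.psiX k p) := fun k hk =>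
    (measurable_weight hS (Finset.mem_range.1 hk)).mul
      (hf.comp (measurable_psiX hS (Finset.mem_range.1 hk)))
  simp only [Fe]
  rw [lintegral_finsetSum _ hmeas]
  refine Finset.sum_congr rfl fun k hk => ?_
  rw [lintegral_map hf (measurable_psiX hS (Finset.mem_range.1 hk))]
  exact lintegral_withDensity_eq_lintegral_mul m (measurable_weight hS (Finset.mem_range.1 hk))
    (hf.comp (measurable_psiX hS (Finset.mem_range.1 hk)))

/-- Conformality concerns continuous test functions only. Finite Borel measures on a metrizable
space are determined by these, and the space is metrizable because `W` is countable. -/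
lemma dualF_eq (hS : S.IsAConvex) (hs : 0 < s) (hC : S.CondC s) {m : Measure S.X}
    (hm : S.IsConformal s m) : S.dualF s m = ENNReal.ofReal (S.gam s m) • m := by
  have := secondCountableTopology (W_countable hS)
  have := TopologicalSpace.metrizableSpace_of_t3_secondCountable S.X
  let := TopologicalSpace.metrizableSpaceMetric S.X
  have := hm.prob
  have hfin : IsFiniteMeasure (S.dualF s m) := by
    refine ⟨?_⟩
    rw [← lintegral_one, lintegral_dualF hS m measurable_const]
    have hle : ∀ p, S.Fe s (fun _ => 1) p ≤
        ENNReal.ofReal ((∑ k ∈ Finset.range S.N, S.dpsiX k (plus S.W 0) ^ s) * 1) := by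
      intro p
      have := ofReal_F (s := s) hS (f := fun _ => 1) (fun _ => zero_le_one) p
      simp only [ENNReal.ofReal_one] at this
      rw [← this]
      exact ENNReal.ofReal_le_ofReal (F_le hS hs hC zero_le_one (fun _ => le_rfl) p)
    refine (lintegral_mono hle).trans_lt ?_
    rw [lintegral_const, measure_univ, mul_one]
    exact ENNReal.ofReal_lt_top
  have hfin' : IsFiniteMeasure (ENNReal.ofReal (S.gam s m) • m) :=
    ⟨by rw [Measure.smul_apply, measure_univ]; simp⟩
  refine ext_of_forall_lintegral_eq_of_IsFiniteMeasure fun f => ?_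
  have hfm : Measurable fun p => (f p : ENNReal) := f.continuous.measurable.coe_nnreal_ennreal
  have hfc : Continuous fun p => (f p : ℝ) := NNReal.continuous_coe.comp f.continuous
  have hf0 : ∀ p, (0 : ℝ) ≤ f p := fun p => (f p).2
  obtain ⟨K, hK⟩ : ∃ K : ℝ, ∀ p, (f p : ℝ) ≤ K := by
    refine ⟨dist f 0, fun p => ?_⟩
    have := f.dist_coe_le_dist (g := 0) p
    rwa [BoundedContinuousFunction.coe_zero, Pi.zero_apply, NNReal.dist_eq, NNReal.coe_zero,
      sub_zero, abs_of_nonneg (hf0 p)] at this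
  have hK' : ∀ p, (f p : ℝ) ≤ max K 0 := fun p => (hK p).trans (le_max_left _ _)
  have hint : Integrable (fun p => (f p : ℝ)) m :=
    Integrable.of_bound hfc.measurable.aestronglyMeasurable (max K 0)
      (Eventually.of_forall fun p => by rw [Real.norm_of_nonneg (hf0 p)]; exact hK' p)
  have hintF : Integrable (S.F s fun p => (f p : ℝ)) m :=
    Integrable.of_bound (measurable_F hS hfc.measurable).aestronglyMeasurable
      ((∑ k ∈ Finset.range S.N, S.dpsiX k (plus S.W 0) ^ s) * max K 0)
      (Eventually.of_forall fun p => by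
        rw [Real.norm_of_nonneg (F_nonneg hS hf0 p)]
        exact F_le hS hs hC (le_max_right _ _) hK' p)
  have hcoe : ∀ p, (f p : ENNReal) = ENNReal.ofReal (f p : ℝ) := fun p =>
    (ENNReal.ofReal_coe_nnreal).symm
  rw [lintegral_dualF hS m hfm, lintegral_smul_measure, smul_eq_mul]
  simp only [hcoe]
  have h := hm.integral_eq _ hfc
  calc ∫⁻ p, S.Fe s (fun q => ENNReal.ofReal (f q : ℝ)) p ∂m
      = ∫⁻ p, ENNReal.ofReal (S.F s (fun q => (f q : ℝ)) p) ∂m :=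
        lintegral_congr fun p => (ofReal_F hS hf0 p).symm
    _ = ENNReal.ofReal (∫ p, S.F s (fun q => (f q : ℝ)) p ∂m) :=
        (ofReal_integral_eq_lintegral_ofReal hintF (Eventually.of_forall (F_nonneg hS hf0))).symm
    _ = _ := by
        rw [h, ENNReal.ofReal_mul hm.gam_pos.le,
          ofReal_integral_eq_lintegral_ofReal hint (Eventually.of_forall hf0)]

lemma lintegral_Fe (hS : S.IsAConvex) (hs : 0 < s) (hC : S.CondC s) {m : Measure S.X}
    (hm : S.IsConformal s m) {f : S.X → ENNReal} (hf : Measurable f) :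
    ∫⁻ p, S.Fe s f p ∂m = ENNReal.ofReal (S.gam s m) * ∫⁻ p, f p ∂m := by
  rw [← lintegral_dualF hS m hf, dualF_eq hS hs hC hm, lintegral_smul_measure, smul_eq_mul]

/-! ### Normalised iterates of the constant function -/

variable (S) in
/-- The normalised iterates of the constant function. -/
def iter (s : ℝ) (m : Measure S.X) (n : ℕ) (p : S.X) : ℝ :=
  (S.F s)^[n] (fun _ => 1) p / S.gam s m ^ n

section iter

variable {m : Measure S.X}

lemma iter_succ (m : Measure S.X) (n : ℕ) (p : S.X) :
    S.iter s m (n + 1) p = S.F s (S.iter s m n) p / S.gam s m := by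
  simp only [iter, Function.iterate_succ_apply', F, pow_succ, mul_div_assoc', ← Finset.sum_div,
    div_div]

lemma F_iterate_nonneg (hS : S.IsAConvex) {f : S.X → ℝ} (hf : ∀ p, 0 ≤ f p) (n : ℕ) :
    ∀ p, 0 ≤ (S.F s)^[n] f p := by
  induction n with
  | zero => exact hf
  | succ n ih => intro p; rw [Function.iterate_succ_apply']; exact F_nonneg hS ih p

lemma F_iterate_le (hS : S.IsAConvex) (hs : 0 < s) (hC : S.CondC s) {f : S.X → ℝ}
    {K : ℝ} (hK : 0 ≤ K) (hf : ∀ p, f p ≤ K) (n : ℕ) : ∃ K', 0 ≤ K' ∧ ∀ p, (S.F s)^[n] f p ≤ K' := by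
  induction n with
  | zero => exact ⟨K, hK, hf⟩
  | succ n ih =>
    obtain ⟨K', h0, h⟩ := ih
    refine ⟨_, mul_nonneg (Finset.sum_nonneg fun k hk =>
      weight_nonneg (s := s) hS (Finset.mem_range.1 hk) (plus S.W 0)) h0, fun p => ?_⟩
    rw [Function.iterate_succ_apply']
    exact F_le hS hs hC h0 h p

lemma iter_nonneg (hS : S.IsAConvex) (hg : 0 < S.gam s m) (n : ℕ) (p : S.X) :
    0 ≤ S.iter s m n p :=
  div_nonneg (F_iterate_nonneg hS (fun _ => zero_le_one) n p) (pow_pos hg n).le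

lemma iter_antitone (hS : S.IsAConvex) (hs : 0 < s) (hC : S.CondC s) (hg : 0 < S.gam s m) (n : ℕ) :
    Antitone (S.iter s m n) := by
  induction n with
  | zero => intro p q _; simp [iter]
  | succ n ih =>
    intro p q hpq
    rw [iter_succ, iter_succ]
    exact div_le_div_of_nonneg_right (F_antitone hS hs hC (iter_nonneg hS hg n) ih hpq) hg.le

lemma measurable_iter (hS : S.IsAConvex) (hs : 0 < s) (hC : S.CondC s) (hg : 0 < S.gam s m)
    (n : ℕ) : Measurable (S.iter s m n) := by
  have := secondCountableTopology (W_countable hS)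
  exact (iter_antitone hS hs hC hg n).measurable

lemma Fe_iter (hS : S.IsAConvex) (hg : 0 < S.gam s m) (n : ℕ) (p : S.X) :
    S.Fe s (fun q => ENNReal.ofReal (S.iter s m n q)) p =
      ENNReal.ofReal (S.gam s m) * ENNReal.ofReal (S.iter s m (n + 1) p) := by
  rw [← ofReal_F hS (iter_nonneg hS hg n), ← ENNReal.ofReal_mul hg.le, iter_succ,
    mul_div_cancel₀ _ hg.ne']

lemma lintegral_iter (hS : S.IsAConvex) (hs : 0 < s) (hC : S.CondC s) (hm : S.IsConformal s m)
    (n : ℕ) : ∫⁻ p, ENNReal.ofReal (S.iter s m n p) ∂m = 1 := by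
  have := hm.prob
  induction n with
  | zero => simp [iter]
  | succ n ih =>
    have h := lintegral_Fe hS hs hC hm (measurable_iter hS hs hC hm.gam_pos n).ennreal_ofReal
    simp only [Fe_iter hS hm.gam_pos] at h
    rw [ih, lintegral_const_mul _ (measurable_iter hS hs hC hm.gam_pos _).ennreal_ofReal,
      ENNReal.mul_right_inj (by simpa using hm.gam_pos) ENNReal.ofReal_ne_top] at h
    exact h

/-- A non-increasing density is bounded by the inverse of the measure of an initial segment. -/
lemma iter_le_inv (hS : S.IsAConvex) (hs : 0 < s) (hC : S.CondC s) (hm : S.IsConformal s m)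
    (n : ℕ) {p : S.X} (hp : m (Iic p) ≠ 0) : S.iter s m n p ≤ (m (Iic p)).toReal⁻¹ := by
  have := hm.prob
  have h : ENNReal.ofReal (S.iter s m n p) * m (Iic p) ≤ 1 := by
    rw [← lintegral_iter hS hs hC hm n]
    refine le_trans ?_ (setLIntegral_le_lintegral (Iic p) _)
    rw [← setLIntegral_const]
    exact setLIntegral_mono' measurableSet_Iic fun q hq =>
      ENNReal.ofReal_le_ofReal (iter_antitone hS hs hC hm.gam_pos n hq)
  have h2 := ENNReal.toReal_mono ENNReal.one_ne_top h
  rw [ENNReal.toReal_mul, ENNReal.toReal_ofReal (iter_nonneg hS hm.gam_pos n p),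
    ENNReal.toReal_one] at h2
  rwa [← one_div, le_div_iff₀ (ENNReal.toReal_pos hp (measure_ne_top _ _))]

end iter

end PiecewiseMap

lemma exists_bound_of_le_mul_add {u : ℕ → ℝ} {q C : ℝ} (hq0 : 0 ≤ q) (hq : q < 1)
    (h : ∀ n, u (n + 1) ≤ q * u n + C) : ∃ K, ∀ n, u n ≤ K := by
  refine ⟨max (u 0) (C / (1 - q)), fun n => ?_⟩
  induction n with
  | zero => exact le_max_left _ _
  | succ n ih =>
    have h1 : C ≤ (1 - q) * max (u 0) (C / (1 - q)) := by
      have := (div_le_iff₀' (show 0 < 1 - q by linarith)).1 (le_max_right (u 0) (C / (1 - q)))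
      exact this
    nlinarith [h n, mul_le_mul_of_nonneg_left ih hq0]

/-! ### The left end of the support -/

namespace PiecewiseMap

open SplitInterval

variable {S : PiecewiseMap} {s : ℝ} {m : Measure S.X}

lemma measurable_pt (hS : S.IsAConvex) : Measurable (pt : S.X → ℝ) := by
  have := secondCountableTopology (W_countable hS)
  exact pt_mono.measurable

/-- The left end point of the support of a probability measure: either an atom, or a point with
no mass that is a limit of the support from the right. -/
lemma exists_left_end [IsProbabilityMeasure m] :
    ∃ c : S.X, m (Iio c) = 0 ∧ (m {c} ≠ 0 ∨ (c.tag = true ∧ c.pt < 1 ∧ m {p | p.pt = c.pt} = 0 ∧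
      ∀ x, c.pt < x → m {p | c.pt < p.pt ∧ p.pt < x} ≠ 0)) := by
  let A : Set ℝ := {x | x ∈ Icc (0 : ℝ) 1 ∧ m {p | p.pt ≤ x} ≠ 0}
  have h1A : (1 : ℝ) ∈ A := by
    refine ⟨⟨zero_le_one, le_rfl⟩, ?_⟩
    have : {p : S.X | p.pt ≤ 1} = univ := eq_univ_of_forall fun p => p.pt_mem.2
    rw [this, measure_univ]
    exact one_ne_zero
  have hbdd : BddBelow A := ⟨0, fun x hx => hx.1.1⟩
  set x := sInf A with hx
  have hx01 : x ∈ Icc (0 : ℝ) 1 := ⟨le_csInf ⟨1, h1A⟩ fun y hy => hy.1.1, csInf_le hbdd h1A⟩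
  have hlow : m {p | p.pt < x} = 0 := by
    have hsub : {p : S.X | p.pt < x} ⊆ ⋃ q ∈ {q : ℚ | (q : ℝ) < x}, {p : S.X | p.pt ≤ q} := by
      intro p hp
      obtain ⟨q, h1, h2⟩ := exists_rat_btwn (show p.pt < x from hp)
      exact mem_iUnion₂.2 ⟨q, h2, h1.le⟩
    refine measure_mono_null hsub ((measure_biUnion_null_iff (to_countable _)).2 ?_)
    intro q hq
    have hqA : (q : ℝ) ∉ A := fun h => absurd (csInf_le hbdd h) (not_le.2 hq)
    by_contra hne
    refine hqA ⟨⟨?_, (le_of_lt hq).trans hx01.2⟩, hne⟩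
    by_contra! hlt
    refine hne ?_
    have : {p : S.X | p.pt ≤ q} = ∅ :=
      eq_empty_of_forall_notMem fun p hp => absurd (p.pt_mem.1.trans hp) (not_le.2 hlt)
    rw [this, measure_empty]
  have hplus : (plus S.W x).pt = x := plus_pt hx01
  have hIio : Iio (plus S.W x) ⊆ {p | p.pt < x} ∪ ({p | p.pt = x} ∩ {minus S.W x}) := by
    intro p hp
    have hle := (le_plus hx01).1 (le_of_lt hp)
    rcases hle.lt_or_eq with h | h
    · exact Or.inl h
    · refine Or.inr ⟨h, ?_⟩
      cases ht : p.tag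
      · have := eq_minus ht
        rwa [h] at this
      · have := eq_plus ht
        rw [h] at this
        exact absurd this (ne_of_lt hp)
  by_cases hat : m {p | p.pt = x} = 0
  · refine ⟨plus S.W x, measure_mono_null hIio (measure_union_null hlow
      (measure_mono_null inter_subset_left hat)), Or.inr ⟨rfl, ?_, ?_, ?_⟩⟩
    · rw [hplus]
      refine lt_of_le_of_ne hx01.2 fun h1 => ?_
      have huniv : (univ : Set S.X) ⊆ {p | p.pt < x} ∪ {p | p.pt = x} := by
        intro p _
        have := p.pt_mem.2
        rw [← h1] at this
        exact this.lt_or_eq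
      have := measure_mono_null huniv (measure_union_null hlow hat)
      rw [measure_univ] at this
      exact one_ne_zero this
    · rwa [hplus]
    · rw [hplus]
      intro y hy h0
      obtain ⟨a, ha, hay⟩ := exists_lt_of_csInf_lt ⟨1, h1A⟩ hy
      refine ha.2 (measure_mono_null (t := ({p | p.pt < x} ∪ {p | p.pt = x}) ∪
        {p | x < p.pt ∧ p.pt < y}) ?_ (measure_union_null (measure_union_null hlow hat) h0))
      intro p hp
      rcases lt_trichotomy p.pt x with h | h | h
      · exact Or.inl (Or.inl h)
      · exact Or.inl (Or.inr h)
      · exact Or.inr ⟨h, lt_of_le_of_lt hp hay⟩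
  -- The points over `x` carry mass: `x⁻` is chosen if it is an atom, and otherwise `x⁺` must be
  -- one.
  · by_cases hmin : m {minus S.W x} = 0
    · refine ⟨plus S.W x, measure_mono_null hIio (measure_union_null hlow
        (measure_mono_null inter_subset_right hmin)), Or.inl fun h0 => hat ?_⟩
      refine measure_mono_null (t := {minus S.W x} ∪ {plus S.W x}) ?_ (measure_union_null hmin h0)
      intro p hp
      have hp : p.pt = x := hp
      cases ht : p.tag
      · exact Or.inl (hp ▸ eq_minus ht)
      · exact Or.inr (hp ▸ eq_plus ht)
    · refine ⟨minus S.W x, measure_mono_null ?_ hlow, Or.inl hmin⟩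
      intro p hp
      by_contra hge
      exact absurd ((minus_le hx01).2 (not_lt.1 hge)) (not_le.2 hp)

/-- For adjacent cylinders strictness comes from the gap between `(a j)⁻` and `(a j)⁺`. -/
lemma lt_of_mem_cylinders (hS : S.IsAConvex) {i j : ℕ} (hij : i < j) (hj : j < S.N) {p q : S.X}
    (hp : p ∈ Icc (plus S.W (S.a i)) (minus S.W (S.a (i + 1))))
    (hq : q ∈ Icc (plus S.W (S.a j)) (minus S.W (S.a (j + 1)))) : p < q := by
  refine hp.2.trans_lt (lt_of_lt_of_le ?_ hq.1)
  rcases (show i + 1 ≤ j from hij).lt_or_eq with h | h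
  · refine lt_of_pt_lt ?_
    rw [minus_pt (a_mem_Icc (h.le.trans hj.le)), plus_pt (a_mem_Icc hj.le)]
    exact a_strict h hj.le
  · rw [h]
    exact minus_lt_plus (a_mem_Icc hj.le) (a_mem_W hS (by omega) hj)

/-- At an interior point outside `W` the derivatives are continuous, so the left derivative stored
in `dpsi` is also the limit from the right. -/
lemma tendsto_dpsi_right (hS : S.IsAConvex) {k : ℕ} (hk : k < S.N) {c : S.X} (ht : c.tag = true)
    (h0 : 0 < c.pt) (h1 : c.pt < 1) : Tendsto (S.dpsi k) (𝓝[>] c.pt) (𝓝 (S.dpsiX k c)) := by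
  by_cases hW : c.pt ∈ S.W
  · have := tendsto_dpsiX hS hk c
    rwa [approach, if_pos hW, ht, if_pos rfl] at this
  · have hV : c.pt ∉ S.V := fun h => hW (mem_W_of_mem_V ⟨h0, h1⟩ h)
    rw [dpsiX, if_neg hW]
    exact (continuousAt_dpsi hS hk ⟨h0, h1⟩ hV).tendsto.mono_left nhdsWithin_le_nhds

/-- Lower semicontinuity of the weights from the right. -/
lemma exists_le_weight_right (hS : S.IsAConvex) (hs : 0 < s) {k : ℕ} (hk : k < S.N) {c : S.X}
    (ht : c.tag = true) (h0 : 0 < c.pt) (h1 : c.pt < 1) {η : ℝ} (hη : η < S.dpsiX k c ^ s) :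
    ∃ y, c.pt < y ∧ ∀ p : S.X, c.pt < p.pt → p.pt < y → η ≤ S.dpsiX k p ^ s := by
  have hev := ((tendsto_dpsi_right hS hk ht h0 h1).rpow_const (Or.inr hs.le)).eventually
    (lt_mem_nhds hη)
  obtain ⟨y, hy, hsub⟩ := (mem_nhdsGT_iff_exists_Ioo_subset' (show c.pt < 1 from h1)).1 hev
  refine ⟨y, hy, fun p h2 h3 => ?_⟩
  refine ge_of_tendsto ((tendsto_dpsiX hS hk p).rpow_const (Or.inr hs.le)) ?_
  filter_upwards [approach_le p (Ioo_mem_nhds h2 h3)] with u hu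
  exact le_of_lt (hsub hu)

lemma weight_pos_of_ne (hS : S.IsAConvex) {k : ℕ} (hk : k < S.N) {p : S.X}
    (h : S.dpsiX k p ^ s ≠ 0) : 0 < S.dpsiX k p ^ s :=
  lt_of_le_of_ne (weight_nonneg hS hk p) (Ne.symm h)

/-- Inverse branches of positive weight map the left end of the support into its convex hull. -/
lemma le_psiX_of_weight_ne_zero (hS : S.IsAConvex) (hs : 0 < s) (hC : S.CondC s)
    (hm : S.IsConformal s m) {c : S.X} (hc : m (Iio c) = 0) (ht : c.tag = true) (h1 : c.pt < 1)
    (hpos : ∀ x, c.pt < x → m {p | c.pt < p.pt ∧ p.pt < x} ≠ 0) {k : ℕ} (hk : k < S.N)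
    (hw : S.dpsiX k c ^ s ≠ 0) : c ≤ S.psiX k c := by
  have hc' : c = plus S.W c.pt := eq_plus ht
  rcases c.pt_mem.1.eq_or_lt with h0 | h0
  · rw [hc', ← h0]
    exact plus_zero_le _
  by_contra! hlt
  -- The inequality might only be `ψ_k(c) = c⁻ < c⁺ = c`. The tag can drop only when `c` is at or
  -- beyond the supremum of the image, and there the limit of the derivative from the right is `0`.
  have hpt : S.psi k c.pt < c.pt := by
    have hle := pt_mono hlt.le
    rw [psiX_pt hk] at hle
    refine lt_of_le_of_ne hle fun heq => ?_
    have htag : (S.psiX k c).tag = false := by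
      rcases lt_iff.1 hlt with h | ⟨_, h⟩
      · rw [psiX_pt hk] at h
        exact absurd heq h.ne
      · exact (Bool.lt_iff.1 h).1
    rcases psiX_cases hk c with ⟨_, h⟩ | ⟨h, _⟩ | ⟨_, _, h⟩
    · rw [h] at htag
      exact absurd htag (by simp)
    · refine dpsiX_ne_zero_of_weight hs hw (tendsto_nhds_unique
        (tendsto_dpsi_right hS hk ht h0 h1) (tendsto_const_nhds.congr' ?_))
      filter_upwards [self_mem_nhdsWithin] with u hu
      exact (dpsi_eq_zero_of_gt hk (h.trans_lt hu)).symm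
    · rw [h, ht, if_pos rfl] at htag
      exact absurd htag (by simp)
  have hwpos := weight_pos_of_ne hS hk hw
  obtain ⟨y, hy, hyw⟩ := exists_le_weight_right hS hs hk ht h0 h1 (half_lt_self hwpos)
  have hev := (psi_continuous hk).tendsto c.pt |>.eventually (gt_mem_nhds hpt)
  obtain ⟨z, hz, hsub⟩ := (mem_nhdsGT_iff_exists_Ioo_subset' (show c.pt < 1 from h1)).1
    (mem_nhdsWithin_of_mem_nhds hev)
  -- Since `Iio c` is null, `F` of its indicator vanishes a.e. By lower semicontinuity of the weight
  -- it would be positive on an interval of positive mass to the right of `c`.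
  have hmeas : MeasurableSet (Iio c) := measurableSet_Iio
  have hint := lintegral_Fe hS hs hC hm
    (f := (Iio c).indicator fun _ => 1) (measurable_const.indicator hmeas)
  rw [lintegral_indicator_const hmeas, hc, mul_zero, mul_zero,
    lintegral_eq_zero_iff (measurable_Fe hS (measurable_const.indicator hmeas))] at hint
  refine hpos (min y z) (lt_min hy hz) (measure_mono_null ?_ (ae_iff.1 hint))
  rintro p ⟨hp1, hp2⟩
  rw [mem_ofPred_eq, Pi.zero_apply]
  refine ne_of_gt (lt_of_lt_of_le ?_
    (Finset.single_le_sum (fun _ _ => zero_le) (Finset.mem_range.2 hk)))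
  have hin : S.psiX k p ∈ Iio c := by
    refine lt_of_pt_lt ?_
    rw [psiX_pt hk]
    exact hsub ⟨hp1, hp2.trans_le (min_le_right _ _)⟩
  rw [indicator_of_mem hin, mul_one, ENNReal.ofReal_pos]
  exact (half_pos hwpos).trans_le (hyw p hp1 (hp2.trans_le (min_le_left _ _)))

section LeftEnd

variable {c : S.X}

/-- The map does not leave the interval to the left of the support. -/
lemma T_le_left_end (hS : S.IsAConvex) (ht : c.tag = true) (h0 : 0 < c.pt) (h1 : c.pt < 1)
    (hψ : ∀ k < S.N, S.dpsiX k c ^ s ≠ 0 → c ≤ S.psiX k c) :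
    ∀ y ∈ Icc 0 c.pt, S.T y ≤ c.pt := by
  -- By induction over the branches, the first branch whose image exceeds `c` is to be excluded. It
  -- takes the value `c` at some `z < y < c`, so `ψ_j c = z < c`, and it remains to see that its
  -- weight at `c` is positive.
  have key : ∀ j, j < S.N → ∀ y ∈ S.branch j, y < c.pt → S.T y ≤ c.pt := by
    intro j
    induction j using Nat.strong_induction_on with
    | _ j ih =>
    intro hj y hy hyx
    by_contra! hlt
    have himg : ∀ i < j, ∀ z ∈ S.branch i, S.T z ≤ c.pt := fun i hi z hz =>
      ih i hi (hi.trans hj) z hz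
        ((hz.2.trans_le (a_le (show i + 1 ≤ j from hi) hj.le)).trans_le (hy.1.trans hyx.le))
    have hleft := T_left_le hS hj h0.le himg
    have hsup := T_lt_branchSup hj hy
    obtain ⟨z, hz, hzx⟩ := exists_T_eq hj hleft (hlt.trans hsup)
    have hzy : z < y := by
      by_contra! h
      have := (S.strictMonoOn j hj).monotoneOn hy hz h
      linarith
    have hpsi : S.psi j c.pt = z := by rw [← hzx]; exact psi_T hj hz
    obtain ⟨v, hv1, hv2⟩ := exists_between hlt
    have hv : S.psi j v < y := by
      obtain ⟨t, htb, htv⟩ := exists_T_eq hj (hleft.trans hv1.le) (hv2.trans hsup)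
      rw [← htv, psi_T hj htb]
      by_contra! h
      have := (S.strictMonoOn j hj).monotoneOn hy htb h
      linarith
    have hD : 0 < S.dpsiSum (j + 1) v := by
      have h2 := psiSum_sub_le hS (Nat.succ_le_of_lt hj) (h0.trans hv1).le hv2
      rw [Nat.succ_eq_add_one, psiSum_succ, psiSum_succ, psi_T hj hy,
        psiSum_eq_of_image_le hj.le himg hlt.le, psiSum_eq_of_image_le hj.le himg hv1.le] at h2
      by_contra! h3
      nlinarith
    -- Just to the right of `c` the earlier branches contribute nothing, so the monotone `dpsiSum (j
    -- + 1)` equals `dpsi j` there and stays above its positive value at `v`.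
    have hpos : 0 < S.dpsiX j c := by
      refine hD.trans_le (ge_of_tendsto (tendsto_dpsi_right hS hj ht h0 h1) ?_)
      filter_upwards [Ioo_mem_nhdsGT hv1] with u hu
      have h3 := dpsiSum_antitoneOn hS (Nat.succ_le_of_lt hj) (h0.trans hu.1).le
        (h0.trans hv1).le hu.2.le
      have h4 : S.dpsiSum j u = 0 := Finset.sum_eq_zero fun i hi => by
        rw [Finset.mem_range] at hi
        exact dpsi_eq_zero_of_gt (hi.trans hj)
          ((branchSup_le (hi.trans hj) (himg i hi)).trans_lt hu.1)
      rwa [Nat.succ_eq_add_one, dpsiSum_succ j u, h4, zero_add] at h3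
    have := pt_mono (hψ j hj (Real.rpow_pos_of_pos hpos s).ne')
    rw [psiX_pt hj, hpsi] at this
    linarith
  have key' : ∀ y, 0 ≤ y → y < c.pt → S.T y ≤ c.pt := fun y hy0 hy => by
    obtain ⟨j, hj, hb⟩ := exists_branch hy0 (hy.trans h1)
    exact key j hj y hb hy
  rintro y ⟨hy0, hy⟩
  rcases hy.lt_or_eq with hy | rfl
  · exact key' y hy0 hy
  · obtain ⟨j, hj, hb⟩ := exists_branch hy0 h1
    rcases hb.1.lt_or_eq with h | h
    · refine le_of_tendsto ((continuousAt_T hj ⟨h, hb.2⟩).tendsto.mono_left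
        (nhdsWithin_le_nhds (s := Iio c.pt))) ?_
      filter_upwards [Ioo_mem_nhdsLT h0] with z hz using key' z hz.1.le hz.2
    · have := T_left_le hS hj hy0 fun i hi z hz => key i (hi.trans hj) z hz
        ((hz.2.trans_le (a_le (show i + 1 ≤ j from hi) hj.le)).trans_eq h)
      rwa [h] at this

/-- An inverse branch that fixes the left end of the support does not expand to the right. -/
lemma psi_le_self (hS : S.IsAConvex) (h0 : 0 < c.pt) (hT : ∀ y ∈ Icc 0 c.pt, S.T y ≤ c.pt)
    {i : ℕ} (hi : i < S.N) (hfix : S.psi i c.pt = c.pt) {z : ℝ} (hz : c.pt ≤ z) :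
    S.psi i z ≤ z := by
  rcases hz.eq_or_lt with rfl | hz
  · exact hfix.le
  have hai : S.a i ≤ c.pt := hfix ▸ (psi_mem hi c.pt).1
  have himg : ∀ j < i, ∀ y ∈ S.branch j, S.T y ≤ c.pt := fun j hj y hy =>
    hT y ⟨(branch_subset (hj.trans hi) hy).1,
      (hy.2.trans_le (a_le (show j + 1 ≤ i from hj) hi.le)).le.trans hai⟩
  have h1 := psiSum_sub_le hS (Nat.succ_le_of_lt hi) h0.le hz
  have h2 := le_psiSum_sub hS (Nat.succ_le_of_lt hi) le_rfl h0
  rw [Nat.succ_eq_add_one, psiSum_succ, psiSum_succ, psiSum_eq_of_image_le hi.le himg hz.le,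
    psiSum_eq_of_image_le hi.le himg le_rfl, hfix] at h1
  -- The earlier branches together gain at most `a i`, and branch `i` at most `c - a i`. The mean
  -- slope over `[0, c]` is thus at most `1`, and by concavity so is every slope to the right of
  -- `c`.
  have h3 : S.psiSum i c.pt - S.psiSum i 0 ≤ S.a i := by
    have : ∑ j ∈ Finset.range i, (S.a (j + 1) - S.a j) = S.a i := by
      rw [Finset.sum_range_sub, S.a_zero, sub_zero]
    rw [← this, psiSum, psiSum, ← Finset.sum_sub_distrib]
    refine Finset.sum_le_sum fun j hj => ?_
    have hj' := (Finset.mem_range.1 hj).trans hi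
    exact sub_le_sub (psi_mem hj' _).2 (psi_mem hj' _).1
  have h4 := (psi_mem hi 0).1
  rw [Nat.succ_eq_add_one, psiSum_succ, psiSum_succ, hfix] at h2
  have h5 : S.dpsiSum (i + 1) c.pt ≤ 1 := by
    by_contra! h
    nlinarith
  nlinarith

/-- If the weight exceeded some `η > γ` near `c`, then, as `ψ_i` maps `(c, y)` into `[c, y)`,
testing conformality on this interval would give `η m(B) ≤ γ m(B')` with `m(B') ≤ m(B)` and `m(B) >
0`. The left end is included in `B'` because `ψ_i` may collapse points to `c`; it has no mass. -/
lemma weight_le_gam (hS : S.IsAConvex) (hs : 0 < s) (hC : S.CondC s) (hm : S.IsConformal s m)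
    (ht : c.tag = true) (h0 : 0 < c.pt) (h1 : c.pt < 1) (hat : m {p | p.pt = c.pt} = 0)
    (hpos : ∀ x, c.pt < x → m {p | c.pt < p.pt ∧ p.pt < x} ≠ 0)
    (hT : ∀ y ∈ Icc 0 c.pt, S.T y ≤ c.pt) {i : ℕ} (hi : i < S.N) (hfix : S.psi i c.pt = c.pt) :
    S.dpsiX i c ^ s ≤ S.gam s m := by
  have := hm.prob
  by_contra! hlt
  obtain ⟨η, hη1, hη2⟩ := exists_between hlt
  obtain ⟨y, hy, hyw⟩ := exists_le_weight_right hS hs hi ht h0 h1 hη2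
  let B : Set S.X := {p | c.pt < p.pt ∧ p.pt < y}
  let B' : Set S.X := {p | c.pt ≤ p.pt ∧ p.pt < y}
  have hBm : MeasurableSet B := measurable_pt hS measurableSet_Ioo
  have hBm' : MeasurableSet B' := measurable_pt hS measurableSet_Ico
  have hBB' : m B' ≤ m B := by
    have hsub : B' ⊆ B ∪ {p | p.pt = c.pt} := fun p hp => by
      rcases hp.1.lt_or_eq with h | h
      · exact Or.inl ⟨h, hp.2⟩
      · exact Or.inr h.symm
    calc m B' ≤ m B + m {p | p.pt = c.pt} := (measure_mono hsub).trans (measure_union_le _ _)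
      _ = m B := by rw [hat, add_zero]
  have hint := lintegral_Fe hS hs hC hm
    (f := B'.indicator fun _ => 1) (measurable_const.indicator hBm')
  rw [lintegral_indicator_const hBm', one_mul] at hint
  have hlow : ENNReal.ofReal η * m B ≤ ∫⁻ p, S.Fe s (B'.indicator fun _ => 1) p ∂m := by
    rw [← lintegral_indicator_const hBm]
    refine lintegral_mono fun p => ?_
    by_cases hp : p ∈ B
    · have hin : S.psiX i p ∈ B' := by
        refine ⟨?_, ?_⟩
        · rw [psiX_pt hi, ← hfix]
          exact psi_mono hi hp.1.le
        · rw [psiX_pt hi]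
          exact (psi_le_self hS h0 hT hi hfix hp.1.le).trans_lt hp.2
      rw [indicator_of_mem hp]
      refine le_trans ?_ (Finset.single_le_sum (fun _ _ => zero_le) (Finset.mem_range.2 hi))
      rw [indicator_of_mem hin, mul_one]
      exact ENNReal.ofReal_le_ofReal (hyw p hp.1 hp.2)
    · rw [indicator_of_notMem hp]
      exact zero_le
  rw [hint] at hlow
  have hcmp := (ENNReal.mul_le_mul_iff_left (hpos y hy) (measure_ne_top _ _)).1
    (hlow.trans (mul_le_mul_right hBB' _))
  rw [ENNReal.ofReal_le_ofReal_iff hm.gam_pos.le] at hcmp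
  linarith

end LeftEnd

end PiecewiseMap

/-! ### Condition (B) and the bound at the left end -/

namespace PiecewiseMap

open SplitInterval

variable {S : PiecewiseMap} {s : ℝ} {m : Measure S.X}

/-- Condition (B) excludes arbitrarily long admissible cylinders whose characteristic functions
have large normalised iterates. -/
lemma CondB.exists_small (hB : S.CondB s m) (hS : S.IsAConvex) (hs : 0 < s) (hC : S.CondC s)
    {ε : ℝ} (hε : 0 < ε) (hg : 0 < S.gam s m) (d : ∀ r, Fin r → ℕ) (hd : ∀ r i, d r i < S.N)
    (h1 : ∀ r, 0 < r → plus S.W S.beta ∉ S.cylinder (d r))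
    (h2 : ∀ r, 0 < r → minus S.W S.beta ∉ S.cylinder (d r)) :
    ∃ r, 0 < r ∧ ∃ n, ∀ p,
      (S.F s)^[n] ((S.cylinder (d r)).indicator fun _ => 1) p / S.gam s m ^ n < ε := by
  obtain ⟨M, _, hM, hMr⟩ := hB
  obtain ⟨r, hr, hr0⟩ := ((hM.eventually (gt_mem_nhds hε)).and (eventually_gt_atTop 0)).exists
  refine ⟨r, hr0, ?_⟩
  by_contra! hcon
  have hnn : ∀ p, 0 ≤ (S.cylinder (d r)).indicator (fun _ => (1 : ℝ)) p := fun p =>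
    indicator_nonneg (fun _ _ => zero_le_one) p
  have hle : ∀ p, (S.cylinder (d r)).indicator (fun _ => (1 : ℝ)) p ≤ 1 := fun p =>
    indicator_le_self' (fun _ _ => zero_le_one) p
  refine absurd (hMr r (d r) (hd r) (h1 r hr0) (h2 r hr0)) (not_le.2 (hr.trans_le ?_))
  refine le_ciInf fun n => ?_
  obtain ⟨p, hp⟩ := hcon n
  refine hp.trans (div_le_div_of_nonneg_right ?_ (pow_pos hg n).le)
  obtain ⟨K, _, hK⟩ := F_iterate_le (s := s) hS hs hC zero_le_one hle n
  refine (le_abs_self _).trans (le_ciSup (f := fun p =>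
    |(S.F s)^[n] ((S.cylinder (d r)).indicator fun _ => 1) p|) ⟨K, ?_⟩ p)
  rintro _ ⟨q, rfl⟩
  change |_| ≤ K
  rw [abs_of_nonneg (F_iterate_nonneg hS hnn n q)]
  exact hK q

lemma weight_mul_le_F (hS : S.IsAConvex) {f : S.X → ℝ} (hf : ∀ p, 0 ≤ f p) {k : ℕ} (hk : k < S.N)
    (p : S.X) : S.dpsiX k p ^ s * f (S.psiX k p) ≤ S.F s f p :=
  Finset.single_le_sum (f := fun k => S.dpsiX k p ^ s * f (S.psiX k p))
    (fun _ hj => mul_nonneg (weight_nonneg hS (Finset.mem_range.1 hj) p) (hf _))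
    (Finset.mem_range.2 hk)

lemma weight_pow_mul_le_F_iterate (hS : S.IsAConvex) {f : S.X → ℝ} (hf : ∀ p, 0 ≤ f p) {k : ℕ}
    (hk : k < S.N) {c : S.X} (hfix : S.psiX k c = c) (n : ℕ) :
    (S.dpsiX k c ^ s) ^ n * f c ≤ (S.F s)^[n] f c := by
  induction n with
  | zero => simp
  | succ n ih =>
    rw [Function.iterate_succ_apply']
    refine le_trans ?_ (weight_mul_le_F hS (F_iterate_nonneg hS hf n) hk c)
    rw [hfix, pow_succ', mul_assoc]
    exact mul_le_mul_of_nonneg_left ih (weight_nonneg hS hk c)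

lemma beta_mem_Icc (hS : S.IsAConvex) : S.beta ∈ Icc (0 : ℝ) 1 :=
  ⟨(a_nonneg (Nat.succ_le_of_lt S.N_pos)).trans (a_one_lt_beta hS).le,
    beta_le le_rfl (a_le_one (Nat.succ_le_of_lt S.N_pos)) fun _ hy => (S.mapsTo hy).2⟩

section LeftEnd

variable {c : S.X}

lemma TX_iterate_eq_of_psiX_fixed (hS : S.IsAConvex) (hs : 0 < s) {i : ℕ} (hi : i < S.N)
    (hfix : S.psiX i c = c) (hw : S.dpsiX i c ^ s ≠ 0) (n : ℕ) : S.TX^[n] c = c := by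
  have h : S.TX c = c := by
    have := TX_psiX hS hi (dpsiX_ne_zero_of_weight hs hw)
    rwa [hfix] at this
  exact Function.iterate_fixed h n

/-- At the left end point `0` the fixed branch contracts strictly relative to `γ`. -/
lemma weight_zero_lt_gam (hS : S.IsAConvex) (hs : 0 < s) (hC : S.CondC s) (hB : S.CondB s m)
    (hg : 0 < S.gam s m) (h0 : c.pt = 0) {i : ℕ} (hi : i < S.N) (hfix : S.psiX i c = c)
    (hw : S.dpsiX i c ^ s ≠ 0) : S.dpsiX i c ^ s < S.gam s m := by
  have hi0 : i = 0 := by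
    by_contra hne
    have h1 := pt_mono (psiX_mem hi c).1
    rw [hfix, plus_pt (a_mem_Icc hi.le), h0, ← S.a_zero] at h1
    exact absurd (a_strict (Nat.pos_of_ne_zero hne) hi.le) (not_lt.2 h1)
  subst hi0
  by_contra! hge
  have ha1 := a_mem_Icc (S := S) (Nat.succ_le_of_lt hi)
  have hmem : ∀ r, 0 < r → ∀ p ∈ S.cylinder (fun _ : Fin r => 0), p.pt ≤ S.a 1 := by
    intro r hr p hp
    have := pt_mono (hp ⟨0, hr⟩).2
    rwa [zero_add, minus_pt ha1] at this
  have hβ := beta_mem_Icc hS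
  obtain ⟨r, hr, n, hn⟩ := hB.exists_small hS hs hC one_pos hg (fun r _ => 0) (fun _ _ => hi)
    (fun r hr h => by
      have := hmem r hr _ h
      rw [plus_pt hβ] at this
      exact absurd (a_one_lt_beta hS) (not_lt.2 this))
    (fun r hr h => by
      have := hmem r hr _ h
      rw [minus_pt hβ] at this
      exact absurd (a_one_lt_beta hS) (not_lt.2 this))
  have hc : c ∈ S.cylinder (fun _ : Fin r => 0) := fun l => by
    rw [TX_iterate_eq_of_psiX_fixed hS hs hi hfix hw]
    have := psiX_mem hi c
    rwa [hfix] at this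
  have hlow := weight_pow_mul_le_F_iterate (s := s) hS
    (f := (S.cylinder (fun _ : Fin r => 0)).indicator fun _ => 1)
    (fun p => indicator_nonneg (fun _ _ => zero_le_one) p) hi hfix n
  rw [indicator_of_mem hc, mul_one] at hlow
  refine absurd (hn c) (not_lt.2 ?_)
  rw [le_div_iff₀ (pow_pos hg n), one_mul]
  exact (pow_le_pow_left₀ hg.le hge n).trans hlow

/-- If the fixed branch does not contract relative to `γ`, then no other branch reaches the left
end of the support. -/
lemma weight_eq_zero_of_gam_le (hS : S.IsAConvex) (hs : 0 < s) (hC : S.CondC s)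
    (hB : S.CondB s m) (hg : 0 < S.gam s m) (ht : c.tag = true) (hβc : S.beta ≤ c.pt)
    (hψ : ∀ k < S.N, S.dpsiX k c ^ s ≠ 0 → c ≤ S.psiX k c) {i : ℕ} (hi : i < S.N)
    (hfix : S.psiX i c = c) (hw : S.gam s m ≤ S.dpsiX i c ^ s) {j : ℕ} (hj : j < S.N)
    (hij : j ≠ i) : S.dpsiX j c ^ s = 0 := by
  by_contra hwj
  have hwi : S.dpsiX i c ^ s ≠ 0 := (hg.trans_le hw).ne'
  have hci : c ∈ Icc (plus S.W (S.a i)) (minus S.W (S.a (i + 1))) := by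
    have := psiX_mem hi c
    rwa [hfix] at this
  -- The point `c` is in cylinder `i`, and `ψ_j c ≥ c` forbids a cylinder further left.
  have hij' : i < j := by
    rcases lt_or_gt_of_ne hij with h | h
    · exact absurd (lt_of_mem_cylinders hS h hi (psiX_mem hj c) hci) (not_lt.2 (hψ j hj hwj))
    · exact h
  have hβ := beta_mem_Icc hS
  have hβ1 : plus S.W S.beta ≤ c := by
    have h1 := eq_plus ht
    rw [h1]
    exact plus_mono hβc
  -- The word `j i i … i`: its cylinder contains `ψ_j c` and lies strictly to the right of `c ≥ β`,
  -- so (B) applies.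
  let d : ∀ r, Fin r → ℕ := fun r l => if l.val = 0 then j else i
  have hfirst : ∀ r, 0 < r → ∀ p ∈ S.cylinder (d r), c < p := fun r hr p hp =>
    lt_of_mem_cylinders hS hij' hj hci (hp ⟨0, hr⟩)
  have hwpos := weight_pos_of_ne hS hj hwj
  obtain ⟨r, hr, n, hn⟩ := hB.exists_small hS hs hC
    (lt_min one_pos (div_pos hwpos hg)) hg d
    (fun r l => by simp only [d]; split_ifs; exacts [hj, hi])
    (fun r hr h => absurd (hfirst r hr _ h) (not_lt.2 hβ1))
    (fun r hr h => absurd (hfirst r hr _ h) (not_lt.2 ((minus_le_plus _).trans hβ1)))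
  have hmem : S.psiX j c ∈ S.cylinder (d r) := by
    rintro ⟨l, hl⟩
    rcases l with _ | l
    · exact psiX_mem hj c
    · change S.TX^[l + 1] _ ∈ Icc (plus S.W (S.a i)) (minus S.W (S.a (i + 1)))
      rw [Function.iterate_succ_apply, TX_psiX hS hj (dpsiX_ne_zero_of_weight hs hwj),
        TX_iterate_eq_of_psiX_fixed hS hs hi hfix hwi]
      exact hci
  have hnn : ∀ p, 0 ≤ (S.cylinder (d r)).indicator (fun _ => (1 : ℝ)) p := fun p =>
    indicator_nonneg (fun _ _ => zero_le_one) p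
  -- The threshold `min 1 (w_j / γ)` is met for every `n`: for `n = 0` at `ψ_j c`, where the
  -- indicator is `1`, and for `n + 1` at `c`, by one step through branch `j` and `n` steps through
  -- the fixed branch `i`.
  rcases n with _ | n
  · refine absurd (hn (S.psiX j c)) (not_lt.2 ?_)
    rw [Function.iterate_zero, id, indicator_of_mem hmem, pow_zero, div_one]
    exact min_le_left _ _
  · refine absurd (hn c) (not_lt.2 ((min_le_right _ _).trans ?_))
    have h1 := weight_pow_mul_le_F_iterate (s := s) hS (F_nonneg (s := s) hS hnn) hi hfix n
    have h2 := weight_mul_le_F (s := s) hS hnn hj c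
    rw [indicator_of_mem hmem, mul_one] at h2
    rw [Function.iterate_succ_apply, div_le_div_iff₀ hg (pow_pos hg _), pow_succ]
    have h3 := pow_le_pow_left₀ hg.le hw n
    have h4 : S.gam s m ^ n * S.dpsiX j c ^ s ≤
        (S.F s)^[n] (S.F s ((S.cylinder (d r)).indicator fun _ => 1)) c :=
      (mul_le_mul h3 h2 hwpos.le (pow_nonneg (hg.trans_le hw).le n)).trans h1
    nlinarith [mul_le_mul_of_nonneg_right h4 hg.le]

/-- The points `psiX k c` reached with non-zero weight are strictly to the right of `c`, where
`iter_le_inv` gives bounds independent of `n`. -/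
lemma exists_sum_iter_le (hS : S.IsAConvex) (hs : 0 < s) (hC : S.CondC s) (hm : S.IsConformal s m)
    (hIic : ∀ p, c < p → m (Iic p) ≠ 0) (J : Finset ℕ) (hJ : ∀ k ∈ J, k < S.N)
    (hψ : ∀ k ∈ J, S.dpsiX k c ^ s ≠ 0 → c < S.psiX k c) :
    ∃ C, ∀ n, (∑ k ∈ J, S.dpsiX k c ^ s * S.iter s m n (S.psiX k c)) / S.gam s m ≤ C := by
  refine ⟨(∑ k ∈ J, S.dpsiX k c ^ s * (m (Iic (S.psiX k c))).toReal⁻¹) / S.gam s m, fun n => ?_⟩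
  refine div_le_div_of_nonneg_right (Finset.sum_le_sum fun k hk => ?_) hm.gam_pos.le
  by_cases hw : S.dpsiX k c ^ s = 0
  · rw [hw, zero_mul, zero_mul]
  · exact mul_le_mul_of_nonneg_left (iter_le_inv hS hs hC hm n (hIic _ (hψ k hk hw)))
      (weight_nonneg hS (hJ k hk) c)

/-- The normalised iterates are bounded at the left end of the support. -/
lemma exists_iter_le (hS : S.IsAConvex) (hs : 0 < s) (hC : S.CondC s) (hm : S.IsConformal s m)
    (hB : S.CondB s m) (hc : m (Iio c) = 0)
    (hc' : m {c} ≠ 0 ∨ (c.tag = true ∧ c.pt < 1 ∧ m {p | p.pt = c.pt} = 0 ∧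
      ∀ x, c.pt < x → m {p | c.pt < p.pt ∧ p.pt < x} ≠ 0)) :
    ∃ K, ∀ n, S.iter s m n c ≤ K := by
  have hg := hm.gam_pos
  rcases hc' with hat | ⟨ht, h1, hat, hpos⟩
  · refine ⟨_, fun n => iter_le_inv hS hs hC hm n (p := c) fun h0 => hat ?_⟩
    exact measure_mono_null (singleton_subset_iff.2 (mem_Iic.2 le_rfl)) h0
  have hIic : ∀ p, c < p → m (Iic p) ≠ 0 := fun p hp h0 => by
    have hpt : c.pt < p.pt := by
      rcases lt_iff.1 hp with h | ⟨_, h⟩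
      · exact h
      · rw [ht] at h
        exact absurd (Bool.le_true p.tag) (not_le.2 h)
    exact hpos p.pt hpt (measure_mono_null (fun q hq => (lt_of_pt_lt hq.2).le) h0)
  have hψ : ∀ k < S.N, S.dpsiX k c ^ s ≠ 0 → c ≤ S.psiX k c := fun k hk =>
    le_psiX_of_weight_ne_zero hS hs hC hm hc ht h1 hpos hk
  by_cases hex : ∃ i < S.N, S.psiX i c = c ∧ S.dpsiX i c ^ s ≠ 0
  · obtain ⟨i, hi, hfix, hw⟩ := hex
    have hsplit : ∀ n, S.iter s m (n + 1) c = S.dpsiX i c ^ s / S.gam s m * S.iter s m n c +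
        (∑ k ∈ (Finset.range S.N).erase i, S.dpsiX k c ^ s * S.iter s m n (S.psiX k c)) /
          S.gam s m := fun n => by
      rw [iter_succ, F, ← Finset.add_sum_erase _ _ (Finset.mem_range.2 hi), hfix]
      ring
    have hq0 : 0 ≤ S.dpsiX i c ^ s / S.gam s m := div_nonneg (weight_nonneg hS hi c) hg.le
    rcases lt_or_ge (S.dpsiX i c ^ s) (S.gam s m) with hq | hq
    -- Disjointness of the cylinders leaves `i` as the only branch fixing `c`.
    · obtain ⟨C, hC'⟩ := exists_sum_iter_le hS hs hC hm hIic ((Finset.range S.N).erase i)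
        (fun k hk => Finset.mem_range.1 (Finset.mem_of_mem_erase hk)) (fun k hk hwk => by
          have hkN := Finset.mem_range.1 (Finset.mem_of_mem_erase hk)
          refine lt_of_le_of_ne (hψ k hkN hwk) fun heq => ?_
          have h2 := psiX_mem hkN c
          have h3 := psiX_mem hi c
          rw [← heq] at h2
          rw [hfix] at h3
          rcases lt_or_gt_of_ne (Finset.ne_of_mem_erase hk) with h | h
          · exact lt_irrefl _ (lt_of_mem_cylinders hS h hi h2 h3)
          · exact lt_irrefl _ (lt_of_mem_cylinders hS h hkN h3 h2))
      refine exists_bound_of_le_mul_add (C := C) hq0 ((div_lt_one hg).2 hq) fun n => ?_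
      rw [hsplit]
      linarith [hC' n]
    · rcases c.pt_mem.1.eq_or_lt with h0 | h0
      · exact absurd (weight_zero_lt_gam hS hs hC hB hg h0.symm hi hfix hw) (not_lt.2 hq)
      have hT := T_le_left_end hS ht h0 h1 hψ
      have hβc : S.beta ≤ c.pt :=
        beta_le h1.le (a_one_le hS h0 (hT _ ⟨h0.le, le_rfl⟩)) hT
      have hfixpt : S.psi i c.pt = c.pt := by rw [← psiX_pt hi, hfix]
      have hq1 : S.dpsiX i c ^ s / S.gam s m = 1 := by
        rw [div_eq_one_iff_eq hg.ne']
        exact le_antisymm (weight_le_gam hS hs hC hm ht h0 h1 hat hpos hT hi hfixpt) hq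
      -- Only the term of branch `i` survives, with coefficient exactly `1`, so the value at `c`
      -- remains that of the initial function `1`.
      refine ⟨1, fun n => ?_⟩
      induction n with
      | zero => simp [iter]
      | succ n ih =>
        rw [hsplit, hq1, Finset.sum_eq_zero, zero_div, add_zero, one_mul]
        · exact ih
        · intro k hk
          rw [weight_eq_zero_of_gam_le hS hs hC hB hg ht hβc hψ hi hfix hq
            (Finset.mem_range.1 (Finset.mem_of_mem_erase hk)) (Finset.ne_of_mem_erase hk), zero_mul]
  · push Not at hex
    obtain ⟨C, hC'⟩ := exists_sum_iter_le hS hs hC hm hIic (Finset.range S.N)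
      (fun k hk => Finset.mem_range.1 hk) (fun k hk hwk =>
        lt_of_le_of_ne (hψ k (Finset.mem_range.1 hk) hwk) fun heq =>
          hwk (hex k (Finset.mem_range.1 hk) heq.symm))
    refine ⟨max 1 C, fun n => ?_⟩
    rcases n with _ | n
    · simp [iter]
    · rw [iter_succ]
      exact (hC' n).trans (le_max_right _ _)

end LeftEnd

end PiecewiseMap

/-! ### The fixed density and the invariant measures -/

namespace PiecewiseMap

open SplitInterval

variable {S : PiecewiseMap} {s : ℝ} {m : Measure S.X}

/-- The indicator of the null set `Iio c` has `F`-image of integral `0`. Hence changing a function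
to the left of `c` does not affect `Fe` almost everywhere, which permits the truncation in
`exists_fixed_density`. -/
lemma ae_weight_eq_zero_or_le (hS : S.IsAConvex) (hs : 0 < s) (hC : S.CondC s)
    (hm : S.IsConformal s m) {c : S.X} (hc : m (Iio c) = 0) :
    ∀ᵐ p ∂m, ∀ k < S.N, ENNReal.ofReal (S.dpsiX k p ^ s) = 0 ∨ c ≤ S.psiX k p := by
  have hmeas : Measurable ((Iio c).indicator fun _ => (1 : ENNReal)) :=
    measurable_const.indicator measurableSet_Iio
  have hint := lintegral_Fe hS hs hC hm hmeas
  rw [lintegral_indicator_const measurableSet_Iio, hc, mul_zero, mul_zero,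
    lintegral_eq_zero_iff (measurable_Fe hS hmeas)] at hint
  filter_upwards [hint] with p hp k hk
  by_contra! hcon
  have := (Finset.sum_eq_zero_iff.1 hp) k (Finset.mem_range.2 hk)
  rw [indicator_of_mem (show S.psiX k p ∈ Iio c from hcon.2), mul_one] at this
  exact hcon.1 this

lemma Fe_mono {f g : S.X → ENNReal} (h : ∀ p, f p ≤ g p) (p : S.X) :
    S.Fe s f p ≤ S.Fe s g p :=
  Finset.sum_le_sum fun _ _ => mul_le_mul_right (h _) _

/-- A fixed density of the normalised transfer operator. -/
lemma exists_fixed_density (hS : S.IsAConvex) (hs : 0 < s) (hC : S.CondC s)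
    (hm : S.IsConformal s m) (hB : S.CondB s m) :
    ∃ ρ : S.X → ℝ, (∀ p, 0 ≤ ρ p) ∧ Antitone ρ ∧ ∫⁻ p, ENNReal.ofReal (ρ p) ∂m = 1 ∧
      ∀ᵐ p ∂m, S.Fe s (fun q => ENNReal.ofReal (ρ q)) p =
        ENNReal.ofReal (S.gam s m) * ENNReal.ofReal (ρ p) := by
  have := hm.prob
  have := secondCountableTopology (W_countable hS)
  have hg := hm.gam_pos
  set γ := ENNReal.ofReal (S.gam s m) with hγ
  obtain ⟨c, hc, hc'⟩ := exists_left_end (m := m)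
  obtain ⟨K, hK⟩ := exists_iter_le hS hs hC hm hB hc hc'
  have hIci : ∀ᵐ p ∂m, c ≤ p := by
    filter_upwards [measure_eq_zero_iff_ae_notMem.1 hc] with p hp using not_lt.1 hp
  -- Truncation at `K` gives a bound on the whole space and changes nothing on `Ici c`, a set of
  -- full measure. The function `g` below is the limsup of the `u n`.
  let u : ℕ → S.X → ENNReal := fun n p => min (ENNReal.ofReal (S.iter s m n p)) (ENNReal.ofReal K)
  let h : ℕ → S.X → ENNReal := fun n p => ⨆ k, u (n + k) p
  let g : S.X → ENNReal := fun p => ⨅ n, h n p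
  have hu : ∀ n p, c ≤ p → u n p = ENNReal.ofReal (S.iter s m n p) := fun n p hp =>
    min_eq_left (ENNReal.ofReal_le_ofReal ((iter_antitone hS hs hC hg n hp).trans (hK n)))
  have hu_anti : ∀ n, Antitone (u n) := fun n p q hpq =>
    min_le_min_right _ (ENNReal.ofReal_le_ofReal (iter_antitone hS hs hC hg n hpq))
  have hh_anti : ∀ n, Antitone (h n) := fun n p q hpq => iSup_mono fun k => hu_anti (n + k) hpq
  have hg_anti : Antitone g := fun p q hpq => iInf_mono fun n => hh_anti n hpq
  have hhK : ∀ n p, h n p ≤ ENNReal.ofReal K := fun n p => iSup_le fun k => min_le_right _ _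
  have hgK : ∀ p, g p ≤ ENNReal.ofReal K := fun p => (iInf_le _ 0).trans (hhK 0 p)
  have hhn : ∀ p, Antitone fun n => h n p := fun p i j hij => by
    refine iSup_le fun k => ?_
    have := le_iSup (fun l => u (i + l) p) (j - i + k)
    rwa [show i + (j - i + k) = j + k by omega] at this
  have hh_int : ∀ n, 1 ≤ ∫⁻ p, h n p ∂m := fun n => by
    rw [← lintegral_iter hS hs hC hm n]
    refine lintegral_mono_ae ?_
    filter_upwards [hIci] with p hp
    rw [← hu n p hp]
    exact le_iSup (fun k => u (n + k) p) 0
  have hint_lt : ∀ f : S.X → ENNReal, (∀ p, f p ≤ ENNReal.ofReal K) → ∫⁻ p, f p ∂m ≠ ⊤ := by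
    intro f hf
    refine ne_top_of_le_ne_top (b := ENNReal.ofReal K) ENNReal.ofReal_ne_top
      ((lintegral_mono hf).trans ?_)
    rw [lintegral_const, measure_univ, mul_one]
  -- Reverse Fatou: the `h n` decrease to `g`, have integral at least `1` and are bounded by `K`.
  have hg_int : 1 ≤ ∫⁻ p, g p ∂m := by
    rw [lintegral_iInf (fun n => (hh_anti n).measurable) (fun i j hij p => hhn p hij)
      (hint_lt _ (hhK 0))]
    exact le_iInf hh_int
  have hge : ∀ᵐ p ∂m, γ * g p ≤ S.Fe s g p := by
    filter_upwards [ae_weight_eq_zero_or_le hS hs hC hm hc] with p hp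
    have h1 : ∀ n, γ * u (n + 1) p ≤ S.Fe s (u n) p := fun n => by
      have : S.Fe s (u n) p = S.Fe s (fun q => ENNReal.ofReal (S.iter s m n q)) p :=
        Finset.sum_congr rfl fun k hk => by
          rcases hp k (Finset.mem_range.1 hk) with h | h
          · rw [h, zero_mul, zero_mul]
          · rw [hu n _ h]
      rw [this, Fe_iter hS hg]
      exact mul_le_mul_right (min_le_left _ _) _
    have h2 : ∀ n, γ * h (n + 1) p ≤ S.Fe s (h n) p := fun n => by
      rw [ENNReal.mul_iSup]
      refine iSup_le fun k => ?_
      rw [show n + 1 + k = n + k + 1 by omega]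
      exact (h1 (n + k)).trans (Fe_mono (fun q => le_iSup (fun k => u (n + k) q) k) p)
    have ht : ∀ q, Tendsto (fun n => h n q) atTop (𝓝 (g q)) := fun q =>
      tendsto_atTop_iInf (hhn q)
    refine le_of_tendsto_of_tendsto'
      (ENNReal.Tendsto.const_mul ((ht p).comp (tendsto_add_atTop_nat 1))
        (Or.inr ENNReal.ofReal_ne_top))
      (tendsto_finsetSum _ fun k _ => ENNReal.Tendsto.const_mul (ht _)
        (Or.inr ENNReal.ofReal_ne_top)) h2
  have hgm : Measurable g := hg_anti.measurable
  have hG := hint_lt g hgK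
  -- Both sides have integral `γ ∫ g < ∞`, so the inequality `hge` is an equality a.e.
  have heq : (fun p => γ * g p) =ᵐ[m] S.Fe s g := by
    have hint : ∫⁻ p, γ * g p ∂m = γ * ∫⁻ p, g p ∂m := lintegral_const_mul _ hgm
    refine ae_eq_of_ae_le_of_lintegral_le hge ?_ (measurable_Fe hS hgm).aemeasurable ?_
    · rw [hint]
      exact ENNReal.mul_ne_top ENNReal.ofReal_ne_top hG
    · rw [hint, lintegral_Fe hS hs hC hm hgm]
  set G := ∫⁻ p, g p ∂m with hGdef
  have hG0 : G ≠ 0 := (zero_lt_one.trans_le hg_int).ne'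
  have hfin : ∀ p, g p * G⁻¹ ≠ ⊤ := fun p =>
    ENNReal.mul_ne_top (ne_top_of_le_ne_top ENNReal.ofReal_ne_top (hgK p))
      (ENNReal.inv_ne_top.2 hG0)
  -- Only `∫ g ≥ 1` is known, so `g` is divided by its integral.
  refine ⟨fun p => (g p * G⁻¹).toReal, fun p => ENNReal.toReal_nonneg, fun p q hpq =>
    ENNReal.toReal_mono (hfin p) (mul_le_mul_left (hg_anti hpq) _), ?_, ?_⟩
  · simp only [ENNReal.ofReal_toReal (hfin _)]
    rw [lintegral_mul_const _ hgm, ← hGdef, ENNReal.mul_inv_cancel hG0 hG]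
  · simp only [ENNReal.ofReal_toReal (hfin _)]
    filter_upwards [heq] with p hp
    rw [← mul_assoc, hp, Fe, Fe, Finset.sum_mul]
    exact Finset.sum_congr rfl fun k _ => (mul_assoc _ _ _).symm

/-- Wherever a weight is non-zero, `TX` undoes the inverse branch, so the factor `f ∘ TX` leaves the
operator as `f`. -/
lemma Fe_comp_TX_mul (hS : S.IsAConvex) (hs : 0 < s) (f g : S.X → ENNReal) (p : S.X) :
    S.Fe s (fun q => f (S.TX q) * g q) p = f p * S.Fe s g p := by
  rw [Fe, Fe, Finset.mul_sum]
  refine Finset.sum_congr rfl fun k hk => ?_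
  by_cases hw : S.dpsiX k p ^ s = 0
  · rw [hw, ENNReal.ofReal_zero, zero_mul, zero_mul, mul_zero]
  · rw [TX_psiX hS (Finset.mem_range.1 hk) (dpsiX_ne_zero_of_weight hs hw)]
    ring

/-- A fixed density of the normalised transfer operator gives an invariant measure. -/
lemma measurePreserving_withDensity (hS : S.IsAConvex) (hs : 0 < s) (hC : S.CondC s)
    (hm : S.IsConformal s m) {g : S.X → ENNReal} (hgm : Measurable g)
    (hfix : ∀ᵐ p ∂m, S.Fe s g p = ENNReal.ofReal (S.gam s m) * g p) :
    MeasurePreserving S.TX (m.withDensity g) (m.withDensity g) := by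
  refine ⟨measurable_TX hS, Measure.ext fun A hA => ?_⟩
  have hA' := measurable_TX hS hA
  have hi : Measurable (A.indicator fun _ => (1 : ENNReal)) := measurable_const.indicator hA
  rw [Measure.map_apply (measurable_TX hS) hA, withDensity_apply _ hA', withDensity_apply _ hA,
    ← lintegral_indicator hA', ← lintegral_indicator hA]
  have h := lintegral_Fe hS hs hC hm
    (f := fun q => A.indicator (fun _ => 1) (S.TX q) * g q)
    ((hi.comp (measurable_TX hS)).mul hgm)
  simp only [Fe_comp_TX_mul hS hs (A.indicator fun _ => 1) g] at h
  have h2 : ∫⁻ p, A.indicator (fun _ => 1) p * S.Fe s g p ∂m =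
      ENNReal.ofReal (S.gam s m) * ∫⁻ p, A.indicator (fun _ => 1) p * g p ∂m := by
    rw [← lintegral_const_mul (ENNReal.ofReal (S.gam s m))
      (f := fun p => A.indicator (fun _ => 1) p * g p) (hi.mul hgm)]
    refine lintegral_congr_ae ?_
    filter_upwards [hfix] with p hp
    rw [hp]
    ring
  rw [h2, ENNReal.mul_right_inj (by simpa using hm.gam_pos) ENNReal.ofReal_ne_top] at h
  have e1 : ∀ p, (S.TX ⁻¹' A).indicator g p = A.indicator (fun _ => 1) (S.TX p) * g p := fun p => by
    by_cases hp : S.TX p ∈ A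
    · rw [indicator_of_mem (show p ∈ S.TX ⁻¹' A from hp), indicator_of_mem hp, one_mul]
    · rw [indicator_of_notMem (show p ∉ S.TX ⁻¹' A from hp), indicator_of_notMem hp, zero_mul]
  have e2 : ∀ p, A.indicator g p = A.indicator (fun _ => 1) p * g p := fun p => by
    by_cases hp : p ∈ A
    · rw [indicator_of_mem hp, indicator_of_mem hp, one_mul]
    · rw [indicator_of_notMem hp, indicator_of_notMem hp, zero_mul]
  simp only [e1, e2]
  exact h.symm

lemma pt_TX_plus {x : ℝ} (hx : x ∈ Icc (0 : ℝ) 1) : (S.TX (plus S.W x)).pt = S.T x := by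
  have hpt : (plus S.W x).pt = x := plus_pt hx
  rcases hx.2.eq_or_lt with rfl | h
  · rw [TX, if_pos (Or.inr hpt), hpt, leftLim_eq_of_tendsto S.continuous_one,
      minus_pt (S.mapsTo hx)]
  · obtain ⟨k, hk, hb⟩ := exists_branch hx.1 h
    rw [TX_of_tag_true hk (by rwa [hpt]) rfl, hpt, plus_pt (S.mapsTo hx)]

/-- An invariant measure without mass on the duplicated points projects to an invariant measure
of the map of the interval. -/
lemma map_pt_preimage_T (hS : S.IsAConvex) {μ : Measure S.X} (hμ : MeasurePreserving S.TX μ μ)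
    (hW : ∀ᵐ p ∂μ, p = plus S.W p.pt) {A : Set ℝ} (hA : MeasurableSet A) :
    μ.map pt (S.T ⁻¹' A) = μ.map pt A := by
  have := secondCountableTopology (W_countable hS)
  have hpt := measurable_pt hS
  have hplus : Measurable (plus S.W) := plus_mono.measurable
  have hB : MeasurableSet {x | (S.TX (plus S.W x)).pt ∈ A} :=
    (hpt.comp ((measurable_TX hS).comp hplus)) hA
  have hIcc : ∀ᵐ x ∂(μ.map pt), x ∈ Icc (0 : ℝ) 1 :=
    (ae_map_iff hpt.aemeasurable measurableSet_Icc).2 (Eventually.of_forall fun p => p.pt_mem)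
  -- The map `T` is arbitrary outside `[0,1]`, so `T ⁻¹' A` is replaced by a measurable set that
  -- agrees with it on `[0,1]`.
  have h1 : μ.map pt (S.T ⁻¹' A) = μ.map pt {x | (S.TX (plus S.W x)).pt ∈ A} := by
    refine measure_congr ?_
    filter_upwards [hIcc] with x hx
    refine propext ?_
    change S.T x ∈ A ↔ (S.TX (plus S.W x)).pt ∈ A
    rw [pt_TX_plus hx]
  rw [h1, Measure.map_apply hpt hB, Measure.map_apply hpt hA,
    ← hμ.measure_preimage (hpt hA).nullMeasurableSet]
  refine measure_congr ?_
  filter_upwards [hW] with p hp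
  refine propext ?_
  change (S.TX (plus S.W p.pt)).pt ∈ A ↔ (S.TX p).pt ∈ A
  rw [← hp]

lemma map_pt_withDensity (hS : S.IsAConvex) (hW : ∀ᵐ p ∂m, p = plus S.W p.pt)
    {g : S.X → ENNReal} (hg : Measurable g) :
    (m.withDensity g).map pt = (m.map pt).withDensity fun x => g (plus S.W x) := by
  have := secondCountableTopology (W_countable hS)
  have hpt := measurable_pt hS
  refine Measure.ext fun A hA => ?_
  rw [Measure.map_apply hpt hA, withDensity_apply _ (hpt hA), withDensity_apply _ hA,
    setLIntegral_map (f := fun x => g (plus S.W x)) hA (hg.comp plus_mono.measurable) hpt]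
  refine lintegral_congr_ae (ae_restrict_of_ae ?_)
  filter_upwards [hW] with p hp
  rw [← hp]

end PiecewiseMap

end

theorem mainTheorem3 (S : PiecewiseMap) (hS : S.IsAConvex)
    (hβ : ∃ k, k ≤ S.N ∧ S.beta = S.a k)
    (s : ℝ) (hs : 0 < s) (hC : S.CondC s)
    (m : Measure S.X) (hm : S.IsConformal s m) (hB : S.CondB s m) :
    (∃ (μ : Measure S.X) (g : S.X → ℝ),
      IsProbabilityMeasure μ ∧ MeasurePreserving S.TX μ μ ∧ μ ≪ m ∧
      (∀ p, 0 ≤ g p) ∧ Antitone g ∧ μ = m.withDensity fun p => ENNReal.ofReal (g p)) ∧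
    (m {p | p.pt ∈ S.W} = 0 →
      ∃ (μ : Measure ℝ) (g : ℝ → ℝ),
        IsProbabilityMeasure μ ∧
        (∀ A, MeasurableSet A → μ (S.T ⁻¹' A) = μ A) ∧ μ ≪ m.map SplitInterval.pt ∧
        g ∈ coneJ ∧ μ = (m.map SplitInterval.pt).withDensity fun x => ENNReal.ofReal (g x)) := by

  have := hm.prob
  have := SplitInterval.secondCountableTopology (PiecewiseMap.W_countable hS)
  obtain ⟨ρ, hρ0, hρa, hρ1, hρf⟩ := PiecewiseMap.exists_fixed_density hS hs hC hm hB
  have hρm : Measurable fun p => ENNReal.ofReal (ρ p) := hρa.measurable.ennreal_ofReal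
  set μ := m.withDensity fun p => ENNReal.ofReal (ρ p) with hμ
  have hprob : IsProbabilityMeasure μ :=
    ⟨by rw [hμ, withDensity_apply _ MeasurableSet.univ, Measure.restrict_univ, hρ1]⟩
  have hinv : MeasurePreserving S.TX μ μ :=
    PiecewiseMap.measurePreserving_withDensity hS hs hC hm hρm hρf
  have hac : μ ≪ m := withDensity_absolutelyContinuous _ _
  refine ⟨⟨μ, ρ, hprob, hinv, hac, hρ0, hρa, rfl⟩, fun hW => ?_⟩
  have hpt := PiecewiseMap.measurable_pt hS
  have hae : ∀ᵐ p ∂m, p = SplitInterval.plus S.W p.pt := by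
    filter_upwards [measure_eq_zero_iff_ae_notMem.1 hW] with p hp
    exact SplitInterval.eq_plus_of_notMem hp
  exact ⟨μ.map SplitInterval.pt, fun x => ρ (SplitInterval.plus S.W x),
    Measure.isProbabilityMeasure_map hpt.aemeasurable,
    fun A hA => PiecewiseMap.map_pt_preimage_T hS hinv (hac.ae_le hae) hA,
    hac.map hpt,
    ⟨fun x _ => hρ0 _, fun x _ y _ hxy => hρa (SplitInterval.plus_mono hxy)⟩,
    PiecewiseMap.map_pt_withDensity hS hae hρm⟩
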